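/- Let $\|\cdot\|$ be the Euclidean norm. On a probability space $(\Omega,\mathcal F,P)$ consider the recursion $$\theta_{n+1}=\theta_n-\alpha_nF(\theta_n,Z_{n+1}),\qquad n\ge 0,$$ where $\alpha_n>0$ are real numbers, $F:\mathbb R^{d_\theta}\times\mathbb R^{d_z}\to\mathbb R^{d_\theta}$ is Borel-measurable, $\theta_0$ is an $\mathbb R^{d_\theta}$-valued random variable and $\{Z_n\}_{n\ge0}$ is an $\mathbb R^{d_z}$-valued process controlled by $\{\theta_n\}$: there are transition probability kernels $\Pi_\theta(\cdot,\cdot)$ on $\mathbb R^{d_z}$, $\theta\in\mathbb R^{d_\theta}$, such that $$P(Z_{n+1}\in B\mid\theta_0,Z_0,\dots,\theta_n,Z_n)=\Pi_{\theta_n}(Z_n,B)$$ w.p.1 for all $n\ge0$ and all Borel sets $B\subseteq\mathbb R^{d_z}$. Let $\gamma_0=0$ and $\gamma_n=\sum_{i=0}^{n-1}\alpha_i$ for $n\geq 1$. Assume: 1. $\lim_n\alpha_n=0$, $\limsup_n|\alpha_{n+1}^{-1}-\alpha_n^{-1}|<\infty$, $\sum_n\alpha_n=\infty$, and $r\in(1,\infty)$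 is a real number such that $\sum_n\alpha_n^2\gamma_n^{2r}<\infty$. 2. $f:\mathbb R^{d_\theta}\to\mathbb R$ is differentiable with locally Lipschitz continuous gradient, and $\tilde F:\mathbb R^{d_\theta}\times\mathbb R^{d_z}\to\mathbb R^{d_\theta}$ is Borel-measurable, with $\tilde F(\theta,\cdot)$ integrable with respect to $\Pi_\theta(z,\cdot)$ and $$F(\theta,z)-\nabla f(\theta)=\tilde F(\theta,z)-(\Pi\tilde F)(\theta,z),\qquad (\Pi\tilde F)(\theta,z)=\int\tilde F(\theta,z')\,\Pi_\theta(z,dz'),$$ for all $\theta,z$. 3. For every compact $Q\subset\mathbb R^{d_\theta}$ and $s\in(0,1)$ there is a Borel-measurable $\varphi_{Q,s}:\mathbb R^{d_z}\to[1,\infty)$ such that $\max\{\|F(\theta,z)\|,\|\tilde F(\theta,z)\|,\|(\Pi\tilde F)(\theta,z)\|\}\le\varphi_{Q,s}(z)$ and $\|(\Pi\tilde F)(\theta',z)-(\Pi\tilde F)(\theta'',z)\|\le\varphi_{Q,s}(z)\|\theta'-\theta''\|^s$ for all $\theta,\theta',\theta''\in Q$ and all $z$. 4. For the functions $\varphi_{Q,s}$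 in 3 and $\tau_Q=\inf\{n\ge0:\theta_n\notin Q\}$, $$\sup_{n\ge0}E\big(\varphi_{Q,s}^2(Z_n)\,I_{\{\tau_Q\ge n\}}\,\big|\,\theta_0=\theta,Z_0=z\big)<\infty$$ for almost every value $(\theta,z)$ of $(\theta_0,Z_0)$, for every compact $Q$ and $s\in(0,1)$. 5. (Łojasiewicz) For every compact $Q\subset\mathbb R^{d_\theta}$ and $a\in f(Q)$ there are $\delta_{Q,a}\in(0,1]$, $\mu_{Q,a}\in(1,2]$, $M_{Q,a}\in[1,\infty)$ such that $|f(\theta)-a|\le M_{Q,a}\|\nabla f(\theta)\|^{\mu_{Q,a}}$ for all $\theta\in Q$ with $|f(\theta)-a|\le\delta_{Q,a}$. Let $\delta_\theta\in(0,1]$, $\mu_\theta\in(1,2]$, $M_\theta\in[1,\infty)$, $\theta\in\mathbb R^{d_\theta}$, be any numbers such that $|f(\theta')-f(\theta)|\le M_\theta\|\nabla f(\theta')\|^{\mu_\theta}$ whenever $\|\theta'-\theta\|\le\delta_\theta$ (such numbers exist by 5). Set $r_\theta=1/(2-\mu_\theta)$ if $\mu_\theta<2$, $r_\theta=\infty$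 if $\mu_\theta=2$, $p_\theta=\mu_\theta\min\{r,r_\theta\}$, $q_\theta=\min\{r,r_\theta\}-1$. Then, with $\Lambda=\{\sup_n\|\theta_n\|<\infty\}$, the following holds. (i) W.p.1 on $\Lambda$, $\hat\theta=\lim_n\theta_n$ exists and $\nabla f(\hat\theta)=0$. Write $\hat p=p_{\hat\theta}$, $\hat q=q_{\hat\theta}$, $\hat r=r_{\hat\theta}$. (ii) W.p.1 on $\Lambda\cap\{\hat r>r\}$: $\|\nabla f(\theta_n)\|^2=o(\gamma_n^{-\hat p})$, $|f(\theta_n)-f(\hat\theta)|=o(\gamma_n^{-\hat p})$ and $\|\theta_n-\hat\theta\|=o(\gamma_n^{-\hat q})$. (iii) W.p.1 on $\Lambda\cap\{\hat r\le r\}$: $\|\nabla f(\theta_n)\|^2=O(\gamma_n^{-\hat p})$, $|f(\theta_n)-f(\hat\theta)|=O(\gamma_n^{-\hat p})$ and $\|\theta_n-\hat\theta\|=O(\gamma_n^{-\hat q})$. (iv) W.p.1 on $\Lambda$: $\|\nabla f(\theta_n)\|^2=o(\gamma_n^{-p})$ and $|f(\theta_n)-f(\hat\theta)|=o(\gamma_n^{-p})$,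 where $p=\min\{1,r\}$. -/

import Mathlib

open MeasureTheory ProbabilityTheory Filter Topology Asymptotics
open scoped ENNReal

noncomputable section

/-- The Euclidean space of dimension `d`. -/
abbrev Eucl (d : ℕ) : Type := EuclideanSpace ℝ (Fin d)

/-- Partial sums of the step sizes: `γ 0 = 0`, `γ n = α 0 + ⋯ + α (n - 1)`. -/
def gam (α : ℕ → ℝ) (n : ℕ) : ℝ := ∑ i ∈ Finset.range n, α i

/-- Step-size conditions, for the exponent `r`. The second limit condition says that
the upper limit of `|1 / α (n + 1) - 1 / α n|` is finite. -/
structure StepSizeCondition (α : ℕ → ℝ) (r : ℝ) : Prop where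
  pos : ∀ n, 0 < α n
  tendsto_zero : Tendsto α atTop (𝓝 0)
  inv_diff_bdd : IsBoundedUnder (· ≤ ·) atTop fun n => |(α (n + 1))⁻¹ - (α n)⁻¹|
  sum_infinite : Tendsto (gam α) atTop atTop
  one_lt : 1 < r
  summable : Summable fun n => α n ^ 2 * gam α n ^ (2 * r)

section Algorithm

variable {Ω : Type*} {dθ dz : ℕ}

/-- The σ-algebra generated by `θ 0, Z 0, …, θ n, Z n`. -/
abbrev history (θ : ℕ → Ω → Eucl dθ) (Z : ℕ → Ω → Eucl dz) (n : ℕ) : MeasurableSpace Ω :=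
  ⨆ k : ℕ, ⨆ _ : k ≤ n,
    (MeasurableSpace.comap (θ k) inferInstance ⊔ MeasurableSpace.comap (Z k) inferInstance)

/-- The algorithm `θ (n + 1) = θ n - α n • F (θ n) (Z (n + 1))`, driven by a process `Z` which is
Markov, controlled by `θ` through the transition probability kernels `K t`. -/
structure IsMarkovStochGrad [MeasurableSpace Ω] (P : Measure Ω) (α : ℕ → ℝ)
    (F : Eucl dθ → Eucl dz → Eucl dθ) (K : Eucl dθ → Kernel (Eucl dz) (Eucl dz))
    (θ : ℕ → Ω → Eucl dθ) (Z : ℕ → Ω → Eucl dz) : Prop where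
  measurable_F : Measurable (Function.uncurry F)
  measurable_init : Measurable (θ 0)
  measurable_Z : ∀ n, Measurable (Z n)
  recursion : ∀ n ω, θ (n + 1) ω = θ n ω - α n • F (θ n ω) (Z (n + 1) ω)
  markovKernel : ∀ t, IsMarkovKernel (K t)
  controlled : ∀ (n : ℕ) (B : Set (Eucl dz)), MeasurableSet B →
    P⟦Z (n + 1) ⁻¹' B | history θ Z n⟧ =ᵐ[P] fun ω => (K (θ n ω) (Z n ω)).real B

/-- `(Π G)(t, z) = ∫ G(t, z') Π_t(z, dz')`. -/
def kernelMean (K : Eucl dθ → Kernel (Eucl dz) (Eucl dz)) (G : Eucl dθ → Eucl dz → Eucl dθ)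
    (t : Eucl dθ) (z : Eucl dz) : Eucl dθ :=
  ∫ z', G t z' ∂(K t z)

/-- `f` is differentiable with locally Lipschitz gradient, and `Ft` solves the Poisson equation
`F - ∇f = Ft - Π Ft`; the integrals that define `Π Ft` exist. -/
structure PoissonCondition (F : Eucl dθ → Eucl dz → Eucl dθ)
    (K : Eucl dθ → Kernel (Eucl dz) (Eucl dz)) (f : Eucl dθ → ℝ)
    (Ft : Eucl dθ → Eucl dz → Eucl dθ) : Prop where
  differentiable : Differentiable ℝ f
  locallyLipschitz_gradient : LocallyLipschitz (gradient f)
  measurable : Measurable (Function.uncurry Ft)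
  integrable : ∀ t z, Integrable (Ft t) (K t z)
  poisson : ∀ t z, F t z - gradient f t = Ft t z - kernelMean K Ft t z

/-- Growth and Hölder conditions, with bounding functions `φ Q s` for compact `Q`
and `0 < s < 1`. -/
structure RegularityCondition (F : Eucl dθ → Eucl dz → Eucl dθ)
    (K : Eucl dθ → Kernel (Eucl dz) (Eucl dz)) (Ft : Eucl dθ → Eucl dz → Eucl dθ)
    (φ : Set (Eucl dθ) → ℝ → Eucl dz → ℝ) : Prop where
  measurable : ∀ Q s, IsCompact Q → s ∈ Set.Ioo (0 : ℝ) 1 → Measurable (φ Q s)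
  one_le : ∀ Q s, IsCompact Q → s ∈ Set.Ioo (0 : ℝ) 1 → ∀ z, 1 ≤ φ Q s z
  bound : ∀ Q s, IsCompact Q → s ∈ Set.Ioo (0 : ℝ) 1 → ∀ t ∈ Q, ∀ z,
    max ‖F t z‖ (max ‖Ft t z‖ ‖kernelMean K Ft t z‖) ≤ φ Q s z
  holder : ∀ Q s, IsCompact Q → s ∈ Set.Ioo (0 : ℝ) 1 → ∀ t ∈ Q, ∀ t' ∈ Q, ∀ z,
    ‖kernelMean K Ft t z - kernelMean K Ft t' z‖ ≤ φ Q s z * ‖t - t'‖ ^ s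

/-- Conditional second moments along the stopped process: with `τ_Q` the first time at which `θ`
is outside `Q`, `sup_n E(φ_{Q,s}(Z_n)² 1{τ_Q ≥ n} | θ_0, Z_0) < ∞`. Conditional expectations
being determined up to null sets, this is asked almost surely, i.e. for almost all initial values;
they are taken in `[0, ∞]`, so that no integrability of the unconditioned variables is required. -/
def MomentCondition [MeasurableSpace Ω] (P : Measure Ω)
    (θ : ℕ → Ω → Eucl dθ) (Z : ℕ → Ω → Eucl dz)
    (φ : Set (Eucl dθ) → ℝ → Eucl dz → ℝ) : Prop :=
  ∀ Q s, IsCompact Q → s ∈ Set.Ioo (0 : ℝ) 1 →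
    ∀ᵐ ω ∂P, ⨆ n : ℕ, condLExp (history θ Z 0) P
      ({ω' | WithTop.some n ≤ hittingAfter θ Qᶜ 0 ω'}.indicator
        fun ω' => ENNReal.ofReal (φ Q s (Z n ω') ^ 2)) ω < ∞

end Algorithm

section Lojasiewicz

variable {d : ℕ}

/-- The Łojasiewicz assumption on `f`. -/
def LojasiewiczCondition (f : Eucl d → ℝ) : Prop :=
  ∀ Q : Set (Eucl d), IsCompact Q → ∀ a ∈ f '' Q,
    ∃ δ ∈ Set.Ioc (0 : ℝ) 1, ∃ μ ∈ Set.Ioc (1 : ℝ) 2, ∃ M ∈ Set.Ici (1 : ℝ),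
      ∀ t ∈ Q, |f t - a| ≤ δ → |f t - a| ≤ M * ‖gradient f t‖ ^ μ

/-- `δ t, μ t, M t` are admissible constants in the local Łojasiewicz inequality of `f` around
each point `t`. -/
structure IsLocalLojasiewicz (f : Eucl d → ℝ) (δ μ M : Eucl d → ℝ) : Prop where
  delta_mem : ∀ t, δ t ∈ Set.Ioc (0 : ℝ) 1
  mu_mem : ∀ t, μ t ∈ Set.Ioc (1 : ℝ) 2
  M_mem : ∀ t, M t ∈ Set.Ici (1 : ℝ)
  ineq : ∀ t t', ‖t' - t‖ ≤ δ t → |f t' - f t| ≤ M t * ‖gradient f t'‖ ^ μ t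

/-- Under the Łojasiewicz assumption such local constants exist. -/
theorem exists_isLocalLojasiewicz {f : Eucl d → ℝ} (hf : Continuous f)
    (h : LojasiewiczCondition f) : ∃ δ μ M, IsLocalLojasiewicz f δ μ M := by
  have key : ∀ t : Eucl d, ∃ δ ∈ Set.Ioc (0 : ℝ) 1, ∃ μ ∈ Set.Ioc (1 : ℝ) 2,
      ∃ M ∈ Set.Ici (1 : ℝ),
      ∀ t', ‖t' - t‖ ≤ δ → |f t' - f t| ≤ M * ‖gradient f t'‖ ^ μ := by
    intro t
    obtain ⟨δ, hδ, μ, hμ, M, hM, hL⟩ := h (Metric.closedBall t 1) (isCompact_closedBall t 1)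
      (f t) ⟨t, Metric.mem_closedBall_self zero_le_one, rfl⟩
    obtain ⟨ε, hε, hc⟩ := Metric.continuousAt_iff.1 hf.continuousAt δ hδ.1
    refine ⟨min (ε / 2) 1, ⟨by positivity, min_le_right _ _⟩, μ, hμ, M, hM, fun t' ht' => ?_⟩
    have h1 := ht'.trans (min_le_left _ _)
    have h2 := ht'.trans (min_le_right _ _)
    refine hL t' (by simpa [dist_eq_norm] using h2) ?_
    have := hc (x := t') (by rw [dist_eq_norm]; linarith)
    rw [Real.dist_eq] at this
    exact this.le
  choose δ hδ μ hμ M hM hL using key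
  exact ⟨δ, μ, M, hδ, hμ, hM, hL⟩

/-- The exponent `1 / (2 - μ)` for `μ < 2`, and `∞` for `μ = 2`. -/
def rExp (μ : ℝ) : EReal := if μ < 2 then ((1 / (2 - μ) : ℝ) : EReal) else ⊤

/-- The exponent `μ * min {r, rExp μ}`; the minimum is a real number. -/
def pExp (r μ : ℝ) : ℝ := μ * (min (r : EReal) (rExp μ)).toReal

/-- The exponent `min {r, rExp μ} - 1`. -/
def qExp (r μ : ℝ) : ℝ := (min (r : EReal) (rExp μ)).toReal - 1

end Lojasiewicz

end

/-! Probability enters only to show that, almost surely where `θ` is bounded, the series of `α n * γ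
n ^ r * ξ n` converges, where `ξ n = F (θ n) (Z (n + 1)) - ∇f (θ n)`. The Poisson equation splits `ξ
n` into a martingale difference, a telescoping term and a Hölder remainder. These are summed by L²
martingale convergence, by Abel summation with slowly varying weights, and by Young's inequality
(`StepSizeCondition.exists_tendsto_noise`, `ae_exists_tendsto_noise`).

The rest is deterministic. The tails `w n` of `∑ α ξ` are `o(γ ^ (-r))`, and the shifted sequence `x
n = θ n - w n` obeys `x (n + 1) = x n - α n (∇f (x n) + e n)` with `e n = ∇f (θ n) - ∇f (x n) = o(γ
^ (-r))` (`exists_perturbedDescent`).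

For `u n = f (x n) - lim f (x)` and `G n = ‖∇f (x n)‖²`, Taylor expansion and the Łojasiewicz
inequality give a discrete form of `u' ≤ -c |u| ^ (2 / μ) + o(γ ^ (-2 r))`. Without noise the
solutions decay like `γ ^ (-μ / (2 - μ))`. The drift balances the noise at `γ ^ (-μ r)`. So the rate
is `γ ^ (-μ m)` with `m = min {r, 1 / (2 - μ)}`, and it is a little-o as long as `m (2 - μ) < 1`. A
barrier argument carries the rate over to `G`. The descent inequality weighted by `γ ^ m` bounds the
remaining path length by `γ ^ (1 - m)`; since `m > 1`, the path converges.

Łojasiewicz is used twice: on a ball at the level `lim f (x)`, to obtain the limit point, and then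
with the local constants at that point, to obtain the stated exponents. -/

/-! ### Power functions and sums along the clock `γ`. -/

/-- A power function with exponent outside `(0, 1)` lies above its tangents. -/
theorem rpow_add_tangent_le {x y a : ℝ} (hx : 0 < x) (hy : 0 < y) (ha : a ≤ 0 ∨ 1 ≤ a) :
    x ^ a + a * x ^ (a - 1) * (y - x) ≤ y ^ a := by
  -- By homogeneity this is Bernoulli's inequality at `y / x`. For `a ≤ 0` it follows from `t ^ a =
  -- exp (a log t) ≥ 1 + a log t` and `log t ≤ t - 1`.
  have key : 1 + a * (y / x - 1) ≤ (y / x) ^ a := by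
    have ht : 0 < y / x := div_pos hy hx
    rcases ha with ha | ha
    · rw [Real.rpow_def_of_pos ht]
      have h1 := Real.add_one_le_exp (Real.log (y / x) * a)
      have h2 := Real.log_le_sub_one_of_pos ht
      nlinarith
    · have := one_add_mul_self_le_rpow_one_add (s := y / x - 1) (by linarith) ha
      simpa using this
  have hxa : 0 < x ^ a := Real.rpow_pos_of_pos hx a
  have h1 := mul_le_mul_of_nonneg_left key hxa.le
  rw [Real.div_rpow hy.le hx.le, mul_div_cancel₀ _ hxa.ne'] at h1
  calc x ^ a + a * x ^ (a - 1) * (y - x) = x ^ a * (1 + a * (y / x - 1)) := by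
        rw [Real.rpow_sub_one hx.ne']; field_simp
    _ ≤ y ^ a := h1

/-- The time scale `γ` with increments `α`. -/
structure IsClock (α γ : ℕ → ℝ) : Prop where
  pos : ∀ n, 0 < α n
  succ : ∀ n, γ (n + 1) = γ n + α n
  tendsto_zero : Tendsto α atTop (𝓝 0)
  tendsto_top : Tendsto γ atTop atTop

namespace IsClock

variable {α γ : ℕ → ℝ}

theorem monotone (h : IsClock α γ) : Monotone γ :=
  monotone_nat_of_le_succ fun n => by rw [h.succ]; linarith [h.pos n]

theorem eventually_one_le (h : IsClock α γ) : ∀ᶠ n in atTop, 1 ≤ γ n :=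
  h.tendsto_top.eventually_ge_atTop 1

theorem eventually_succ_le_two_mul (h : IsClock α γ) : ∀ᶠ n in atTop, γ (n + 1) ≤ 2 * γ n := by
  filter_upwards [h.eventually_one_le, h.tendsto_zero.eventually_le_const zero_lt_one]
    with n h1 h2
  rw [h.succ]; linarith

theorem rpow_neg_le (h : IsClock α γ) {n k : ℕ} (hnk : n ≤ k) (hn : 0 < γ n) {a : ℝ}
    (ha : 0 ≤ a) : γ k ^ (-a) ≤ γ n ^ (-a) :=
  Real.rpow_le_rpow_of_nonpos hn (h.monotone hnk) (by linarith)

theorem tendsto_rpow_neg (h : IsClock α γ) {a : ℝ} (ha : 0 < a) :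
    Tendsto (fun n => γ n ^ (-a)) atTop (𝓝 0) :=
  (tendsto_rpow_neg_atTop ha).comp h.tendsto_top

theorem eventually_mul_rpow_le (h : IsClock α γ) {a b : ℝ} (hab : a < b) (A : ℝ) {B : ℝ}
    (hB : 0 < B) : ∀ᶠ n in atTop, A * γ n ^ (-b) ≤ B * γ n ^ (-a) := by
  have h1 : Tendsto (fun n => A * γ n ^ (-(b - a))) atTop (𝓝 (A * 0)) :=
    (h.tendsto_rpow_neg (sub_pos.2 hab)).const_mul A
  rw [mul_zero] at h1
  filter_upwards [h1.eventually_le_const hB, h.eventually_one_le] with n h2 h3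
  have h4 : γ n ^ (-b) = γ n ^ (-(b - a)) * γ n ^ (-a) := by
    rw [← Real.rpow_add (by linarith)]; congr 1; ring
  rw [h4, ← mul_assoc]
  exact mul_le_mul_of_nonneg_right h2 (Real.rpow_nonneg (by linarith) _)

theorem isLittleO_rpow_neg (h : IsClock α γ) {a b : ℝ} (hab : a < b) :
    (fun n => γ n ^ (-b)) =o[atTop] fun n => γ n ^ (-a) := by
  refine .of_bound fun B hB => ?_
  filter_upwards [h.eventually_mul_rpow_le hab 1 hB, h.eventually_one_le] with n h1 h2
  rw [Real.norm_of_nonneg (Real.rpow_nonneg (by linarith) _),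
    Real.norm_of_nonneg (Real.rpow_nonneg (by linarith) _)]
  linarith

/-- Decrease of a negative power of `γ` over one step, from above. -/
theorem rpow_neg_sub_le (h : IsClock α γ) {n : ℕ} (hn : 0 < γ n) {a : ℝ} (ha : 0 ≤ a) :
    γ n ^ (-a) - γ (n + 1) ^ (-a) ≤ a * α n * γ n ^ (-a - 1) := by
  have := rpow_add_tangent_le (a := -a) hn (hn.trans_le (h.monotone n.le_succ))
    (Or.inl (by linarith))
  rw [h.succ] at this ⊢
  linarith

/-- Comparison with the integral of `t ^ (-m)`: the tangent of `t ^ (1 - m)` at `γ (k + 1)` bounds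
each term by a telescoping difference. Passing from `γ (k + 1)` back to `γ k` costs the factor `2 ^
m`. -/
theorem sum_Ico_le (h : IsClock α γ) {m : ℝ} (hm : 1 < m) :
    ∃ C > 0, ∀ᶠ n in atTop, ∀ j, n ≤ j →
      ∑ k ∈ Finset.Ico n j, α k * γ k ^ (-m) ≤ C * γ n ^ (1 - m) := by
  refine ⟨2 ^ m / (m - 1), div_pos (by positivity) (by linarith), ?_⟩
  obtain ⟨N, hN⟩ := eventually_atTop.1 (h.eventually_one_le.and h.eventually_succ_le_two_mul)
  filter_upwards [eventually_ge_atTop N] with n hn j hj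
  have hstep : ∀ k, n ≤ k → α k * γ k ^ (-m) ≤
      2 ^ m / (m - 1) * (γ k ^ (1 - m) - γ (k + 1) ^ (1 - m)) := by
    intro k hk
    obtain ⟨h1, h2⟩ := hN k (hn.trans hk)
    have hk0 : 0 < γ k := by linarith
    have hk1 : 0 < γ (k + 1) := hk0.trans_le (h.monotone k.le_succ)
    have h3 := rpow_add_tangent_le (a := 1 - m) hk1 hk0 (Or.inl (by linarith))
    have h4 : (2 * γ k) ^ (-m) ≤ γ (k + 1) ^ (-m) :=
      Real.rpow_le_rpow_of_nonpos hk1 h2 (by linarith)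
    rw [Real.mul_rpow (by norm_num) hk0.le, Real.rpow_neg (by norm_num : (0:ℝ) ≤ 2)] at h4
    have h5 : (1 - m) * γ (k + 1) ^ (1 - m - 1) * (γ k - γ (k + 1)) =
        (m - 1) * (α k * γ (k + 1) ^ (-m)) := by
      rw [h.succ, show (1 - m - 1 : ℝ) = -m by ring]; ring
    rw [h5] at h3
    rw [div_mul_eq_mul_div, le_div_iff₀ (by linarith)]
    have h2m : (0 : ℝ) < 2 ^ m := by positivity
    have h6 : α k * γ k ^ (-m) ≤ 2 ^ m * (α k * γ (k + 1) ^ (-m)) := by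
      calc α k * γ k ^ (-m) = 2 ^ m * (α k * ((2 ^ m)⁻¹ * γ k ^ (-m))) := by field_simp
        _ ≤ _ := by
          have := (h.pos k).le
          gcongr
    calc α k * γ k ^ (-m) * (m - 1) ≤ 2 ^ m * (α k * γ (k + 1) ^ (-m)) * (m - 1) := by
          have : 0 ≤ m - 1 := by linarith
          gcongr
      _ = 2 ^ m * ((m - 1) * (α k * γ (k + 1) ^ (-m))) := by ring
      _ ≤ _ := by gcongr; linarith
  calc ∑ k ∈ Finset.Ico n j, α k * γ k ^ (-m)
      ≤ ∑ k ∈ Finset.Ico n j, 2 ^ m / (m - 1) * (γ k ^ (1 - m) - γ (k + 1) ^ (1 - m)) :=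
        Finset.sum_le_sum fun k hk => hstep k (Finset.mem_Ico.1 hk).1
    _ = 2 ^ m / (m - 1) * (γ n ^ (1 - m) - γ j ^ (1 - m)) := by
        rw [← Finset.mul_sum, Finset.sum_Ico_eq_sub _ hj, Finset.sum_range_sub',
          Finset.sum_range_sub']
        ring
    _ ≤ _ := by
        have hm1 : 0 < m - 1 := by linarith
        have : 0 ≤ γ j ^ (1 - m) := Real.rpow_nonneg
          (zero_le_one.trans (hN j (hn.trans hj)).1) _
        gcongr
        linarith

theorem summable_mul_rpow_neg (h : IsClock α γ) {m : ℝ} (hm : 1 < m) :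
    Summable fun n => α n * γ n ^ (-m) := by
  obtain ⟨C, -, hC⟩ := h.sum_Ico_le hm
  obtain ⟨N, hN⟩ := eventually_atTop.1 (hC.and h.eventually_one_le)
  rw [← summable_nat_add_iff N]
  refine summable_of_sum_range_le (c := C * γ N ^ (1 - m)) (fun n => ?_) fun n => ?_
  · exact mul_nonneg (h.pos _).le
      (Real.rpow_nonneg (zero_le_one.trans (hN _ (Nat.le_add_left _ _)).2) _)
  · have := (hN N le_rfl).1 (n + N) (Nat.le_add_left _ _)
    rwa [Finset.sum_Ico_eq_sum_range, Nat.add_sub_cancel,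
      Finset.sum_congr rfl fun k _ => by rw [add_comm N k]] at this

end IsClock

/-! ### Discrete barrier and comparison principles. -/

/-- A sequence that increases as long as it exceeds a decreasing barrier, without being
bounded away from zero, stays below the barrier. -/
theorem le_barrier_of_increasing_above {y B : ℕ → ℝ} {N : ℕ} (hB : ∀ n ≥ N, 0 ≤ B n)
    (hanti : ∀ n ≥ N, B (n + 1) ≤ B n) (hinc : ∀ n ≥ N, B n < y n → y n ≤ y (n + 1))
    (hfreq : ∀ e > 0, ∃ᶠ n in atTop, y n < e) : ∀ n ≥ N, y n ≤ B n := by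
  intro n hn
  by_contra! hlt
  -- Once above the barrier, the sequence never comes back and never falls below `y n > 0`.
  have h1 : ∀ k, n ≤ k → B k < y k ∧ y n ≤ y k := by
    intro k hk
    induction k, hk using Nat.le_induction with
    | base => exact ⟨hlt, le_rfl⟩
    | succ k hk ih =>
      have h2 := hinc k (hn.trans hk) ih.1
      exact ⟨((hanti k (hn.trans hk)).trans_lt ih.1).trans_le h2, ih.2.trans h2⟩
  obtain ⟨k, hk, hk'⟩ := ((hfreq (y n) ((hB n hn).trans_lt hlt)).and_eventually
    (eventually_ge_atTop n)).exists
  exact absurd (h1 k hk').2 (not_le.2 hk)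

/-- Comparison with a supersolution `b` of the difference inequality satisfied by `u`. -/
theorem le_supersolution {α u b w d : ℕ → ℝ} {c κ : ℝ} {N : ℕ} (hα : ∀ n, 0 ≤ α n) (hκ : 1 ≤ κ)
    (hc : 0 ≤ c)
    (hu : ∀ n ≥ N, u (n + 1) ≤ u n - α n * (c * |u n| ^ κ) + α n * w n)
    (hb : ∀ n ≥ N, b n - b (n + 1) ≤ α n * d n)
    (hd : ∀ n ≥ N, d n + w n ≤ c * (b n / 2) ^ κ)
    (hb0 : ∀ n ≥ N, 0 ≤ b n) (hb2 : ∀ n ≥ N, b n ≤ 2) (hcα : ∀ n ≥ N, c * α n ≤ 1)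
    (hN : u N ≤ b N) : ∀ n ≥ N, u n ≤ b n := by
  intro n hn
  induction n, hn using Nat.le_induction with
  | base => exact hN
  | succ n hn ih =>
    have h1 := hu n hn
    have h2 := hb n hn
    have h3 := mul_le_mul_of_nonneg_left (hd n hn) (hα n)
    -- If `u n ≥ b n / 2`, the drift alone outweighs the noise and the decrease of `b`. Otherwise
    -- there is a margin `b n / 2`, which one step cannot exhaust because `c * α n ≤ 1`. No
    -- monotonicity of the update map in `u` is needed.
    rcases le_total (b n / 2) (u n) with h4 | h4
    · have h5 : (b n / 2) ^ κ ≤ |u n| ^ κ :=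
        Real.rpow_le_rpow (by linarith [hb0 n hn]) (h4.trans (le_abs_self _)) (by linarith)
      have h6 := mul_le_mul_of_nonneg_left (mul_le_mul_of_nonneg_left h5 hc) (hα n)
      rw [mul_add] at h3
      linarith
    · have h5 : (b n / 2) ^ κ ≤ b n / 2 := by
        calc (b n / 2) ^ κ ≤ (b n / 2) ^ (1 : ℝ) :=
              Real.rpow_le_rpow_of_exponent_ge' (by linarith [hb0 n hn]) (by linarith [hb2 n hn])
                zero_le_one hκ
          _ = _ := Real.rpow_one _
      have h6 : 0 ≤ α n * (c * |u n| ^ κ) :=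
        mul_nonneg (hα n) (mul_nonneg hc (Real.rpow_nonneg (abs_nonneg _) _))
      have h7 : α n * (c * (b n / 2) ^ κ) ≤ b n / 2 := by
        calc α n * (c * (b n / 2) ^ κ) ≤ α n * (c * (b n / 2)) := by
              have := hα n
              gcongr
          _ = (c * α n) * (b n / 2) := by ring
          _ ≤ 1 * (b n / 2) := by
              have := hb0 n hn
              have := hcα n hn
              gcongr
          _ = _ := one_mul _
      rw [mul_add] at h3
      linarith

/-! ### Decay rates from the scalar descent inequalities. -/

/-- Scalar inequalities of a perturbed gradient descent under a Łojasiewicz inequality: `u` is the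
excess of the objective function, `G` the squared norm of its gradient, `h` the squared size of
the perturbation. -/
structure DescentSystem (α γ u G h : ℕ → ℝ) (L c μ r : ℝ) : Prop where
  clock : IsClock α γ
  L_nonneg : 0 ≤ L
  c_pos : 0 < c
  one_lt_mu : 1 < μ
  mu_le_two : μ ≤ 2
  descent : ∀ᶠ n in atTop, u (n + 1) ≤ u n - α n / 2 * G n + 2 * α n * h n
  slow : ∀ᶠ n in atTop, (1 - L * α n) * G n - L * α n * h n ≤ G (n + 1)
  noise : ∀ ε > 0, ∀ᶠ n in atTop, h n ≤ ε * γ n ^ (-(2 * r))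
  tendsto_zero : Tendsto u atTop (𝓝 0)
  lojasiewicz : ∀ᶠ n in atTop, c * |u n| ^ (2 / μ) ≤ G n

namespace DescentSystem

variable {α γ u G h : ℕ → ℝ} {L c μ r : ℝ}

theorem descent_lojasiewicz (S : DescentSystem α γ u G h L c μ r) :
    ∀ᶠ n in atTop, u (n + 1) ≤ u n - α n * (c / 2 * |u n| ^ (2 / μ)) + α n * (2 * h n) := by
  filter_upwards [S.descent, S.lojasiewicz] with n h1 h2
  have := mul_le_mul_of_nonneg_left h2 (S.clock.pos n).le
  linarith

theorem noise_of_le (S : DescentSystem α γ u G h L c μ r) {s : ℝ} (hs : s ≤ 2 * r) {ε : ℝ}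
    (hε : 0 < ε) : ∀ᶠ n in atTop, h n ≤ ε * γ n ^ (-s) := by
  filter_upwards [S.noise ε hε, S.clock.eventually_one_le] with n h1 h2
  exact h1.trans (mul_le_mul_of_nonneg_left
    (Real.rpow_le_rpow_of_exponent_le h2 (by linarith)) hε.le)

theorem mul_rpow_neg_rpow (S : DescentSystem α γ u G h L c μ r) {n : ℕ} (hn : 0 ≤ γ n) {ε m : ℝ}
    (hε : 0 ≤ ε) : (ε * γ n ^ (-(μ * m))) ^ (2 / μ) = ε ^ (2 / μ) * γ n ^ (-(2 * m)) := by
  have hμ : μ ≠ 0 := by linarith [S.one_lt_mu]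
  rw [Real.mul_rpow hε (Real.rpow_nonneg hn _), ← Real.rpow_mul hn]
  congr 2
  field_simp

theorem one_le_two_div (S : DescentSystem α γ u G h L c μ r) : 1 ≤ 2 / μ := by
  rw [le_div_iff₀ (by linarith [S.one_lt_mu])]; linarith [S.mu_le_two]

/-- Upper rate, subcritical exponent. -/
theorem upper_of_lt (S : DescentSystem α γ u G h L c μ r) {m : ℝ} (hm0 : 0 < m) (hmr : m ≤ r)
    (hm : m * (2 - μ) < 1) {ε : ℝ} (hε : 0 < ε) :
    ∀ᶠ n in atTop, u n ≤ ε * γ n ^ (-(μ * m)) := by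
  have hμ := S.one_lt_mu
  have hμ2 := S.mu_le_two
  have hc := S.c_pos
  have hκ := S.one_le_two_div
  -- The barrier will be `ε / 2 * γ ^ (-(μ m)) + K * γ ^ (-(μ m'))`. The first term absorbs the
  -- noise with a small constant. The second, with `K` large, puts the barrier above `u` at the
  -- starting time and is asymptotically negligible. Subcriticality of both exponents makes the
  -- slope of the barrier of lower order than the drift.
  obtain ⟨m', hm', hm'2⟩ : ∃ m', m < m' ∧ m' * (2 - μ) < 1 :=
    ⟨m + (1 - m * (2 - μ)) / 2, by linarith, by nlinarith⟩
  have hp : 0 < μ * m := by positivity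
  have hp' : 0 < μ * m' := mul_pos (by linarith) (by linarith)
  have hεκ : 0 < (ε / 2 / 2) ^ (2 / μ) := by positivity
  have e1 := S.clock.eventually_mul_rpow_le (a := 2 * m) (b := μ * m + 1) (by linarith)
    (ε / 2 * (μ * m)) (B := c / 2 / 4 * (ε / 2 / 2) ^ (2 / μ)) (by positivity)
  have e2 := S.noise_of_le (s := 2 * m) (by linarith)
    (ε := c / 2 / 8 * (ε / 2 / 2) ^ (2 / μ)) (by positivity)
  have e3 := S.clock.eventually_mul_rpow_le (a := 2 * m') (b := μ * m' + 1) (by linarith)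
    (μ * m') (B := c / 2 / 2 * (1 / 2) ^ (2 / μ)) (by positivity)
  have e4 := ((S.clock.tendsto_rpow_neg hp).const_mul (ε / 2)).eventually_le_const
    (u := 1) (by simp)
  have e5 := (S.clock.tendsto_rpow_neg hp').eventually_le_const zero_lt_one
  have e6 := S.tendsto_zero.abs.eventually_le_const (u := 1) (by simp)
  have e7 := (S.clock.tendsto_zero.const_mul (c / 2)).eventually_le_const (u := 1) (by simp)
  obtain ⟨N, hN⟩ := eventually_atTop.1 (S.clock.eventually_one_le.and <|
    S.descent_lojasiewicz.and <| e1.and <| e2.and <| e3.and <| e4.and <| e5.and <| e6.and e7)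
  -- `K` depends on `N`, so the conditions defining `N` must be free of `K`. That is why `e3` is
  -- stated for coefficient one.
  set K := max 1 (|u N| * γ N ^ (μ * m')) with hK
  have hK1 : 1 ≤ K := le_max_left _ _
  have hγ : ∀ n ≥ N, 0 < γ n := fun n hn => zero_lt_one.trans_le (hN n hn).1
  have hKN : K * γ N ^ (-(μ * m')) ≤ 1 ∧ u N ≤ K * γ N ^ (-(μ * m')) := by
    obtain ⟨-, -, -, -, -, -, h5, h6, -⟩ := hN N le_rfl
    have hpos := Real.rpow_pos_of_pos (hγ N le_rfl) (-(μ * m'))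
    have hinv : γ N ^ (μ * m') * γ N ^ (-(μ * m')) = 1 := by
      rw [← Real.rpow_add (hγ N le_rfl)]; simp
    rw [hK, max_mul_of_nonneg _ _ hpos.le, mul_assoc, hinv, one_mul, mul_one]
    exact ⟨max_le h5 h6, (le_abs_self _).trans (le_max_right _ _)⟩
  have hbd := le_supersolution (α := α) (u := u) (w := fun n => 2 * h n) (κ := 2 / μ)
    (c := c / 2) (N := N)
    (b := fun n => ε / 2 * γ n ^ (-(μ * m)) + K * γ n ^ (-(μ * m')))
    (d := fun n => ε / 2 * (μ * m) * γ n ^ (-(μ * m + 1)) +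
      K * (μ * m' * γ n ^ (-(μ * m' + 1))))
    (fun n => (S.clock.pos n).le) hκ (by positivity) (fun n hn => (hN n hn).2.1)
    (fun n hn => by
      have h1 := S.clock.rpow_neg_sub_le (hγ n hn) hp.le
      have h2 := S.clock.rpow_neg_sub_le (hγ n hn) hp'.le
      rw [show -(μ * m) - 1 = -(μ * m + 1) by ring] at h1
      rw [show -(μ * m') - 1 = -(μ * m' + 1) by ring] at h2
      have h3 := mul_le_mul_of_nonneg_left h1 (half_pos hε).le
      have h4 := mul_le_mul_of_nonneg_left h2 (zero_le_one.trans hK1)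
      linarith)
    (fun n hn => by
      obtain ⟨-, -, h1, h2, h3, -⟩ := hN n hn
      have hg := hγ n hn
      set b := ε / 2 * γ n ^ (-(μ * m)) + K * γ n ^ (-(μ * m')) with hb
      have hb1 : (ε / 2 / 2) ^ (2 / μ) * γ n ^ (-(2 * m)) ≤ (b / 2) ^ (2 / μ) := by
        rw [← S.mul_rpow_neg_rpow hg.le (by positivity)]
        refine Real.rpow_le_rpow (by positivity) ?_ (by positivity)
        have : 0 ≤ K * γ n ^ (-(μ * m')) := by positivity
        rw [hb]; linarith
      -- Since `K ≥ 1` and `2 / μ ≥ 1`, `K ≤ K ^ (2 / μ)`: the drift grows at least linearly in `K`,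
      -- as does the slope of the barrier.
      have hb2 : K * ((1 / 2) ^ (2 / μ) * γ n ^ (-(2 * m'))) ≤ (b / 2) ^ (2 / μ) := by
        calc K * ((1 / 2) ^ (2 / μ) * γ n ^ (-(2 * m')))
            ≤ K ^ (2 / μ) * ((1 / 2) ^ (2 / μ) * γ n ^ (-(2 * m'))) := by
              gcongr
              calc K = K ^ (1 : ℝ) := (Real.rpow_one _).symm
                _ ≤ _ := Real.rpow_le_rpow_of_exponent_le hK1 hκ
          _ = (K / 2 * γ n ^ (-(μ * m'))) ^ (2 / μ) := by
              rw [S.mul_rpow_neg_rpow hg.le (by positivity), div_eq_mul_one_div K 2,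
                Real.mul_rpow (by positivity) (by positivity)]
              ring
          _ ≤ _ := by
              refine Real.rpow_le_rpow (by positivity) ?_ (by positivity)
              have : 0 ≤ ε / 2 * γ n ^ (-(μ * m)) := by positivity
              rw [hb]; linarith
      have h4 := mul_le_mul_of_nonneg_left h3 (zero_le_one.trans hK1)
      have h5 := mul_le_mul_of_nonneg_left hb1 hc.le
      have h6 := mul_le_mul_of_nonneg_left hb2 hc.le
      linarith)
    (fun n hn => by
      have := hγ n hn
      positivity)
    (fun n hn => by
      have h1 := (hN n hn).2.2.2.2.2.1
      have h2 := S.clock.rpow_neg_le hn (hγ N le_rfl) hp'.le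
      have h3 := mul_le_mul_of_nonneg_left h2 (zero_le_one.trans hK1)
      linarith [hKN.1])
    (fun n hn => (hN n hn).2.2.2.2.2.2.2.2)
    (by
      have := hγ N le_rfl
      have : 0 ≤ ε / 2 * γ N ^ (-(μ * m)) := by positivity
      linarith [hKN.2])
  filter_upwards [eventually_ge_atTop N, S.clock.eventually_mul_rpow_le (a := μ * m) (b := μ * m')
    (by gcongr) K (half_pos hε)] with n hn h1
  have := hbd n hn
  linarith

/-- Upper rate, critical exponent. -/
theorem upper_of_eq (S : DescentSystem α γ u G h L c μ r) {m : ℝ} (hm0 : 0 < m) (hmr : m ≤ r)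
    (hm : m * (2 - μ) = 1) : ∃ K > 0, ∀ᶠ n in atTop, u n ≤ K * γ n ^ (-(μ * m)) := by
  have hμ := S.one_lt_mu
  have hc := S.c_pos
  have hκ := S.one_le_two_div
  have hp : 0 < μ * m := by positivity
  have hκ1 : 0 < 2 / μ - 1 := by
    have hμ2 : μ < 2 := by
      refine lt_of_le_of_ne S.mu_le_two fun h2 => ?_
      rw [h2] at hm; norm_num at hm
    rw [sub_pos, lt_div_iff₀ (by linarith)]; linarith
  -- At the critical exponent `μ m + 1 = 2 m`, so slope and drift have the same order in `γ`. A
  -- large coefficient decides, as `K ^ (2 / μ)` is superlinear: the threshold gives `(μ m + 2) K ≤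
  -- c / 2 * (K / 2) ^ (2 / μ)`.
  obtain ⟨K₀, hK₀⟩ := eventually_atTop.1
    (((tendsto_rpow_atTop hκ1).eventually_ge_atTop ((μ * m + 2) * 2 ^ (2 / μ) / (c / 2))).and
      (eventually_ge_atTop 1))
  have e2 := S.noise_of_le (s := 2 * m) (by linarith) (ε := 1) one_pos
  have e5 := ((S.clock.tendsto_rpow_neg hp).const_mul K₀).eventually_le_const (u := 1) (by simp)
  have e6 := S.tendsto_zero.abs.eventually_le_const (u := 1) (by simp)
  have e7 := (S.clock.tendsto_zero.const_mul (c / 2)).eventually_le_const (u := 1) (by simp)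
  obtain ⟨N, hN⟩ := eventually_atTop.1 (S.clock.eventually_one_le.and <|
    S.descent_lojasiewicz.and <| e2.and <| e5.and <| e6.and e7)
  set K := max K₀ (|u N| * γ N ^ (μ * m)) with hK
  obtain ⟨hKκ, hK1⟩ := hK₀ K (le_max_left _ _)
  have hγ : ∀ n ≥ N, 0 < γ n := fun n hn => zero_lt_one.trans_le (hN n hn).1
  have hKN : K * γ N ^ (-(μ * m)) ≤ 1 ∧ u N ≤ K * γ N ^ (-(μ * m)) := by
    obtain ⟨-, -, -, h5, h6, -⟩ := hN N le_rfl
    have hpos := Real.rpow_pos_of_pos (hγ N le_rfl) (-(μ * m))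
    have hinv : γ N ^ (μ * m) * γ N ^ (-(μ * m)) = 1 := by
      rw [← Real.rpow_add (hγ N le_rfl)]; simp
    rw [hK, max_mul_of_nonneg _ _ hpos.le, mul_assoc, hinv, mul_one]
    exact ⟨max_le h5 h6, (le_abs_self _).trans (le_max_right _ _)⟩
  refine ⟨K, by linarith, eventually_atTop.2 ⟨N, ?_⟩⟩
  refine le_supersolution (α := α) (u := u) (w := fun n => 2 * h n) (κ := 2 / μ)
    (c := c / 2) (N := N) (d := fun n => K * (μ * m * γ n ^ (-(2 * m))))
    (fun n => (S.clock.pos n).le) hκ (by positivity) (fun n hn => (hN n hn).2.1)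
    (fun n hn => ?_) (fun n hn => ?_) (fun n hn => ?_) (fun n hn => ?_)
    (fun n hn => (hN n hn).2.2.2.2.2) hKN.2
  · have h1 := S.clock.rpow_neg_sub_le (hγ n hn) hp.le
    rw [show -(μ * m) - 1 = -(2 * m) by linarith] at h1
    have h4 := mul_le_mul_of_nonneg_left h1 (zero_le_one.trans hK1)
    linarith
  · have h1 := (hN n hn).2.2.1
    have hg := hγ n hn
    have h2 : μ * m * K + 2 ≤ c / 2 * (K / 2) ^ (2 / μ) := by
      rw [div_le_iff₀ (by positivity)] at hKκ
      have h3 : (K / 2) ^ (2 / μ) = K ^ (2 / μ - 1) * K / 2 ^ (2 / μ) := by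
        rw [Real.div_rpow (by positivity) (by positivity), Real.rpow_sub_one (by positivity)]
        field_simp
      rw [h3, ← mul_div_assoc, le_div_iff₀ (by positivity)]
      have h4 := mul_le_mul_of_nonneg_right hKκ (zero_le_one.trans hK1)
      have h5 : 0 ≤ (K - 1) * (2 : ℝ) ^ (2 / μ) := by
        have : 0 ≤ K - 1 := by linarith
        positivity
      linarith
    have h3 : (K * γ n ^ (-(μ * m)) / 2) ^ (2 / μ) = (K / 2) ^ (2 / μ) * γ n ^ (-(2 * m)) := by
      rw [← S.mul_rpow_neg_rpow hg.le (by positivity)]; congr 1; ring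
    rw [h3]
    have h4 := mul_le_mul_of_nonneg_right h2 (Real.rpow_nonneg hg.le (-(2 * m)))
    linarith
  · have := hγ n hn
    positivity
  · have h2 := S.clock.rpow_neg_le hn (hγ N le_rfl) hp.le
    have h3 := mul_le_mul_of_nonneg_left h2 (zero_le_one.trans hK1)
    linarith [hKN.1]

/-- When `-u` exceeds the barrier, the drift beats the noise and pushes `u` further down, so `-u`
increases. This is incompatible with `u → 0`. No balance with the slope of the barrier is needed,
hence no condition linking `m` and `μ`. -/
theorem lower (S : DescentSystem α γ u G h L c μ r) {m : ℝ} (hm0 : 0 < m) (hmr : m ≤ r)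
    {ε : ℝ} (hε : 0 < ε) : ∀ᶠ n in atTop, -u n ≤ ε * γ n ^ (-(μ * m)) := by
  have hμ := S.one_lt_mu
  have hc := S.c_pos
  have hκ := S.one_le_two_div
  have hp : 0 < μ * m := by positivity
  have e2 := S.noise_of_le (s := 2 * m) (by linarith)
    (ε := c / 2 / 2 * ε ^ (2 / μ)) (by positivity)
  obtain ⟨N, hN⟩ := eventually_atTop.1 (S.clock.eventually_one_le.and <|
    S.descent_lojasiewicz.and e2)
  have hγ : ∀ n ≥ N, 0 < γ n := fun n hn => zero_lt_one.trans_le (hN n hn).1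
  refine eventually_atTop.2 ⟨N, le_barrier_of_increasing_above (fun n hn => ?_) (fun n hn => ?_)
    (fun n hn hlt => ?_) fun e he => ?_⟩
  · have := hγ n hn
    positivity
  · have := S.clock.rpow_neg_le n.le_succ (hγ n hn) hp.le
    gcongr
  · obtain ⟨-, h1, h2⟩ := hN n hn
    have hg := hγ n hn
    have h3 : ε ^ (2 / μ) * γ n ^ (-(2 * m)) ≤ |u n| ^ (2 / μ) := by
      rw [← S.mul_rpow_neg_rpow hg.le (by positivity)]
      exact Real.rpow_le_rpow (by positivity) (hlt.le.trans (neg_le_abs _)) (by positivity)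
    have h4 : 2 * h n ≤ c / 2 * |u n| ^ (2 / μ) := by
      have := mul_le_mul_of_nonneg_left h3 hc.le
      linarith
    have h5 := mul_le_mul_of_nonneg_left h4 (S.clock.pos n).le
    linarith
  · have := S.tendsto_zero.neg
    rw [neg_zero] at this
    exact (this.eventually_lt_const he).frequently

/-- Otherwise `G ≥ e / 2` eventually, since `u → 0`, and then `u` would lose at least `e / 8` per
unit of the clock `γ`, which is unbounded. -/
theorem frequently_lt (S : DescentSystem α γ u G h L c μ r) (hr : 0 < r) (l : ℝ) {e : ℝ}
    (he : 0 < e) : ∃ᶠ n in atTop, G n - l * u n < e := by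
  intro hev
  have e1 : Tendsto (fun n => l * u n) atTop (𝓝 (l * 0)) := S.tendsto_zero.const_mul l
  rw [mul_zero] at e1
  have e2 := S.noise_of_le (s := r) (by linarith) (ε := e / 16) (by positivity)
  have e3 := (S.clock.tendsto_rpow_neg hr).eventually_le_const zero_lt_one
  obtain ⟨N, hN⟩ := eventually_atTop.1 (hev.and <| (e1.eventually_const_le
    (show -(e / 2) < 0 by linarith)).and <| e2.and <| e3.and S.descent)
  have key : ∀ n ≥ N, u n + e / 8 * γ n ≤ u N + e / 8 * γ N := by
    intro n hn
    induction n, hn using Nat.le_induction with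
    | base => exact le_rfl
    | succ n hn ih =>
      obtain ⟨h1, h2, h3, h4, h5⟩ := hN n hn
      rw [not_lt] at h1
      have h6 : e / 16 * γ n ^ (-r) ≤ e / 16 * 1 := by gcongr
      have h7 : 2 * h n + e / 8 ≤ 1 / 2 * G n := by linarith
      have h8 := mul_le_mul_of_nonneg_left h7 (S.clock.pos n).le
      rw [S.clock.succ]
      linarith
  have h1 : Tendsto (fun n => u n + e / 8 * γ n) atTop atTop :=
    S.tendsto_zero.add_atTop (S.clock.tendsto_top.const_mul_atTop (by positivity))
  obtain ⟨n, hn1, hn2⟩ := ((h1.eventually_gt_atTop (u N + e / 8 * γ N)).and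
    (eventually_ge_atTop N)).exists
  exact absurd (key n hn2) (not_le.2 hn1)

/-- The barrier principle applied to `G - 2 (L + 1) u`. In one step `G` loses at most `L α (G + h)`,
while descent of `u` contributes `(L + 1) α G - 4 (L + 1) α h`. The net gain `α (G - (5 L + 4) h)`
is nonnegative above the barrier. -/
theorem gradient_le (S : DescentSystem α γ u G h L c μ r) (hr : 0 < r) {p B : ℝ} (hp : 0 < p)
    (hpr : p ≤ 2 * r) (hB : 0 < B) (hu : ∀ᶠ n in atTop, |u n| ≤ B * γ n ^ (-p)) :
    ∀ᶠ n in atTop, G n ≤ 6 * (L + 1) * B * γ n ^ (-p) := by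
  have hL := S.L_nonneg
  have e1 := S.noise_of_le hpr (ε := B * (2 * (L + 1)) / (5 * L + 4)) (by positivity)
  obtain ⟨N, hN⟩ := eventually_atTop.1 (S.clock.eventually_one_le.and <| hu.and <|
    S.descent.and <| S.slow.and e1)
  have hγ : ∀ n ≥ N, 0 < γ n := fun n hn => zero_lt_one.trans_le (hN n hn).1
  have := le_barrier_of_increasing_above (y := fun n => G n - 2 * (L + 1) * u n)
    (B := fun n => 4 * (L + 1) * (B * γ n ^ (-p))) (N := N) (fun n hn => ?_)
    (fun n hn => ?_) (fun n hn hlt => ?_) fun e he => S.frequently_lt hr _ he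
  · refine eventually_atTop.2 ⟨N, fun n hn => ?_⟩
    have h1 := this n hn
    have h2 := mul_le_mul_of_nonneg_left ((le_abs_self _).trans (hN n hn).2.1)
      (show 0 ≤ 2 * (L + 1) by positivity)
    linarith
  · have := hγ n hn
    positivity
  · have := S.clock.rpow_neg_le n.le_succ (hγ n hn) hp.le
    gcongr
  · obtain ⟨-, h1, h2, h3, h4⟩ := hN n hn
    have h5 := mul_le_mul_of_nonneg_left (neg_le_of_abs_le h1)
      (show 0 ≤ 2 * (L + 1) by positivity)
    have h6 : (5 * L + 4) * h n ≤ 2 * (L + 1) * (B * γ n ^ (-p)) := by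
      have h7 := mul_le_mul_of_nonneg_left h4 (show 0 ≤ 5 * L + 4 by positivity)
      calc _ ≤ _ := h7
        _ = _ := by field_simp
    have h7 : (5 * L + 4) * h n ≤ G n := by linarith
    have h8 := mul_le_mul_of_nonneg_left h7 (S.clock.pos n).le
    have h9 := mul_le_mul_of_nonneg_left h2 (show 0 ≤ 2 * (L + 1) by positivity)
    linarith

/-- Bound on the length of the trajectory after time `n`. -/
theorem exists_length_le (S : DescentSystem α γ u G h L c μ r) {m : ℝ} (hm1 : 1 < m)
    (hmr : m ≤ r) (hm : m * (2 - μ) ≤ 1) {s : ℕ → ℝ} (hs : ∀ n, s n ^ 2 ≤ 2 * (G n + h n)) :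
    ∃ C > 0, ∀ B > 0, ∀ D > 0, (∀ᶠ n in atTop, |u n| ≤ B * γ n ^ (-(μ * m))) →
      (∀ᶠ n in atTop, h n ≤ D * γ n ^ (-(2 * r))) → ∀ ω > 0, ∀ᶠ n in atTop, ∀ j, n ≤ j →
        ∑ k ∈ Finset.Ico n j, α k * s k ≤ C * (ω + ω⁻¹ * (B + D)) * γ n ^ (1 - m) := by
  obtain ⟨C₀, hC₀, hsum⟩ := S.clock.sum_Ico_le hm1
  -- The constant must not depend on `B`, `D`, `ω`: letting all three be small is what yields the
  -- little-o bound.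
  refine ⟨C₀ + (4 + (2 * m + 5) * C₀), by positivity, fun B hB D hD hu hh ω hω => ?_⟩
  obtain ⟨N, hN⟩ := eventually_atTop.1 (S.clock.eventually_one_le.and <| hu.and <| hh.and <|
    S.descent.and hsum)
  filter_upwards [eventually_ge_atTop N] with n hn j hj
  have hγ : ∀ n ≥ N, 0 < γ n := fun n hn => zero_lt_one.trans_le (hN n hn).1
  -- The descent inequality times `γ k ^ m`, with the weight moved onto `u (k + 1)` by Abel
  -- summation. The resulting error is of order `α γ ^ (m - 1 - μ m)`, which is at most `α γ ^ (-m)`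
  -- exactly because `m * (2 - μ) ≤ 1`.
  have hstep : ∀ k ≥ N, α k * (γ k ^ m * (G k + h k)) ≤
      2 * (γ k ^ m * u k - γ (k + 1) ^ m * u (k + 1)) +
        (2 * m * B + 5 * D) * (α k * γ k ^ (-m)) := by
    intro k hk
    have hg := hγ k hk
    have hk1 : k + 1 ≥ N := by omega
    have hg1 := hγ _ hk1
    have hα := S.clock.pos k
    have h1 := rpow_add_tangent_le (a := m) hg1 hg (Or.inr hm1.le)
    rw [S.clock.succ k] at h1
    have h1' : 0 ≤ γ (k + 1) ^ m - γ k ^ m :=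
      sub_nonneg.2 (Real.rpow_le_rpow hg.le (S.clock.monotone k.le_succ) (by linarith))
    have h2 : (γ (k + 1) ^ m - γ k ^ m) * u (k + 1) ≤ m * B * (α k * γ k ^ (-m)) := by
      calc (γ (k + 1) ^ m - γ k ^ m) * u (k + 1)
          ≤ (γ (k + 1) ^ m - γ k ^ m) * (B * γ (k + 1) ^ (-(μ * m))) :=
            mul_le_mul_of_nonneg_left ((le_abs_self _).trans (hN _ hk1).2.1) h1'
        _ ≤ (m * α k * γ (k + 1) ^ (m - 1)) * (B * γ (k + 1) ^ (-(μ * m))) := by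
            gcongr
            rw [S.clock.succ k]; linarith
        _ = m * B * (α k * γ (k + 1) ^ (m - 1 + -(μ * m))) := by
            rw [Real.rpow_add hg1]; ring
        _ ≤ m * B * (α k * γ (k + 1) ^ (-m)) := by
            gcongr
            · exact (hN _ hk1).1
            · linarith
        _ ≤ _ := by
            have := S.clock.rpow_neg_le k.le_succ hg (show 0 ≤ m by linarith)
            gcongr
    have h3 : γ k ^ m * h k ≤ D * γ k ^ (-m) := by
      calc γ k ^ m * h k ≤ γ k ^ m * (D * γ k ^ (-(2 * r))) := by
            gcongr
            exact (hN k hk).2.2.1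
        _ = D * γ k ^ (m + -(2 * r)) := by rw [Real.rpow_add hg]; ring
        _ ≤ _ := by
            gcongr
            · exact (hN k hk).1
            · linarith
    have h4 := mul_le_mul_of_nonneg_left (hN k hk).2.2.2.1 (Real.rpow_nonneg hg.le m)
    have h5 := mul_le_mul_of_nonneg_left h3 hα.le
    nlinarith
  have henergy : ∑ k ∈ Finset.Ico n j, α k * (γ k ^ m * (G k + h k)) ≤
      (4 + (2 * m + 5) * C₀) * (B + D) * γ n ^ (1 - m) := by
    have hbd : ∀ k ≥ n, |γ k ^ m * u k| ≤ B * γ n ^ (1 - m) := by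
      intro k hk
      have hg := hγ k (hn.trans hk)
      rw [abs_mul, abs_of_nonneg (Real.rpow_nonneg hg.le m)]
      calc γ k ^ m * |u k| ≤ γ k ^ m * (B * γ k ^ (-(μ * m))) := by
            gcongr
            exact (hN k (hn.trans hk)).2.1
        _ = B * γ k ^ (m + -(μ * m)) := by rw [Real.rpow_add hg]; ring
        _ ≤ B * γ k ^ (-(m - 1)) := by
            gcongr
            · exact (hN k (hn.trans hk)).1
            · linarith
        _ ≤ B * γ n ^ (-(m - 1)) := by
            have := S.clock.rpow_neg_le hk (hγ n hn) (show 0 ≤ m - 1 by linarith)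
            gcongr
        _ = _ := by rw [neg_sub]
    have h6 := (abs_le.1 (hbd n le_rfl)).2
    have h7 := (abs_le.1 (hbd j hj)).1
    have h8 := mul_le_mul_of_nonneg_left ((hN n hn).2.2.2.2 j hj)
      (show 0 ≤ 2 * m * B + 5 * D by positivity)
    have hX := Real.rpow_nonneg (hγ n hn).le (1 - m)
    calc ∑ k ∈ Finset.Ico n j, α k * (γ k ^ m * (G k + h k))
        ≤ ∑ k ∈ Finset.Ico n j, (2 * (γ k ^ m * u k - γ (k + 1) ^ m * u (k + 1)) +
          (2 * m * B + 5 * D) * (α k * γ k ^ (-m))) :=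
          Finset.sum_le_sum fun k hk => hstep k (hn.trans (Finset.mem_Ico.1 hk).1)
      _ = 2 * (γ n ^ m * u n - γ j ^ m * u j) +
          (2 * m * B + 5 * D) * ∑ k ∈ Finset.Ico n j, α k * γ k ^ (-m) := by
          rw [Finset.sum_add_distrib, ← Finset.mul_sum, ← Finset.mul_sum,
            Finset.sum_Ico_eq_sub _ hj,
            Finset.sum_range_sub' (fun k => γ k ^ m * u k),
            Finset.sum_range_sub' (fun k => γ k ^ m * u k)]
          ring
      _ ≤ (4 * B + (2 * m * B + 5 * D) * C₀) * γ n ^ (1 - m) := by linarith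
      _ ≤ _ := by
          gcongr
          have : 0 ≤ 4 * D + 5 * C₀ * B + 2 * m * C₀ * D := by positivity
          linarith
  calc ∑ k ∈ Finset.Ico n j, α k * s k
      ≤ ∑ k ∈ Finset.Ico n j, (ω * (α k * γ k ^ (-m)) +
          ω⁻¹ * (α k * (γ k ^ m * (G k + h k)))) := by
        refine Finset.sum_le_sum fun k hk => ?_
        have hg := hγ k (hn.trans (Finset.mem_Ico.1 hk).1)
        have hgm := Real.rpow_pos_of_pos hg m
        -- Weighted arithmetic-geometric mean inequality: it trades the length for the energy just
        -- bounded, plus the summable `α γ ^ (-m)`.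
        have hA : s k ≤ ω * γ k ^ (-m) + ω⁻¹ * (γ k ^ m * (G k + h k)) := by
          have h1 : ω⁻¹ * (γ k ^ m * (s k ^ 2 / 2)) ≤ ω⁻¹ * (γ k ^ m * (G k + h k)) := by
            gcongr
            linarith [hs k]
          refine le_trans ?_ (add_le_add_right h1 _)
          rw [Real.rpow_neg hg.le]
          have h2 : ω * (γ k ^ m)⁻¹ + ω⁻¹ * (γ k ^ m * (s k ^ 2 / 2)) - s k =
              (ω⁻¹ * γ k ^ m / 2) * ((s k - ω * (γ k ^ m)⁻¹) ^ 2 +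
                (ω * (γ k ^ m)⁻¹) ^ 2) := by
            field_simp
            ring
          have h3 : 0 ≤ (ω⁻¹ * γ k ^ m / 2) * ((s k - ω * (γ k ^ m)⁻¹) ^ 2 +
                (ω * (γ k ^ m)⁻¹) ^ 2) := by positivity
          linarith
        have := mul_le_mul_of_nonneg_left hA (S.clock.pos k).le
        linarith
    _ = ω * ∑ k ∈ Finset.Ico n j, α k * γ k ^ (-m) +
          ω⁻¹ * ∑ k ∈ Finset.Ico n j, α k * (γ k ^ m * (G k + h k)) := by
        rw [Finset.sum_add_distrib, ← Finset.mul_sum, ← Finset.mul_sum]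
    _ ≤ ω * (C₀ * γ n ^ (1 - m)) +
          ω⁻¹ * ((4 + (2 * m + 5) * C₀) * (B + D) * γ n ^ (1 - m)) := by
        gcongr
        exact (hN n hn).2.2.2.2 j hj
    _ ≤ _ := by
        have hX := Real.rpow_nonneg (hγ n hn).le (1 - m)
        have : 0 ≤ (ω * (4 + (2 * m + 5) * C₀) + ω⁻¹ * (B + D) * C₀) * γ n ^ (1 - m) := by
          positivity
        linarith

end DescentSystem

namespace DescentSystem

variable {α γ u G h : ℕ → ℝ} {L c μ r : ℝ}

theorem littleO_rates (S : DescentSystem α γ u G h L c μ r) {m : ℝ} (hm1 : 1 < m) (hmr : m ≤ r)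
    (hm : m * (2 - μ) < 1) {s : ℕ → ℝ} (hs : ∀ n, s n ^ 2 ≤ 2 * (G n + h n)) {ε : ℝ}
    (hε : 0 < ε) :
    (∀ᶠ n in atTop, |u n| ≤ ε * γ n ^ (-(μ * m))) ∧
    (∀ᶠ n in atTop, G n ≤ ε * γ n ^ (-(μ * m))) ∧
    (∀ᶠ n in atTop, ∀ j, n ≤ j → ∑ k ∈ Finset.Ico n j, α k * s k ≤ ε * γ n ^ (1 - m)) := by
  have hm0 : 0 < m := by linarith
  have hμ := S.one_lt_mu
  have hμ2 := S.mu_le_two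
  have hL := S.L_nonneg
  have hu : ∀ ε > 0, ∀ᶠ n in atTop, |u n| ≤ ε * γ n ^ (-(μ * m)) := by
    intro ε hε
    filter_upwards [S.upper_of_lt hm0 hmr hm hε, S.lower hm0 hmr hε] with n h1 h2
    exact abs_le'.2 ⟨h1, h2⟩
  refine ⟨hu ε hε, ?_, ?_⟩
  · have h1 := S.gradient_le (p := μ * m) (B := ε / (6 * (L + 1))) (by linarith) (by positivity)
      (by nlinarith) (by positivity) (hu _ (by positivity))
    filter_upwards [h1] with n h1
    calc _ ≤ _ := h1
      _ = _ := by field_simp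
  · obtain ⟨C, hC, hlen⟩ := S.exists_length_le hm1 hmr hm.le hs
    -- With `B = D = ω ^ 2 / 2` the length constant `C (ω + ω⁻¹ (B + D))` equals `2 C ω = ε`.
    set ω := ε / (2 * C) with hω
    have hω0 : 0 < ω := by positivity
    filter_upwards [hlen (ω ^ 2 / 2) (by positivity) (ω ^ 2 / 2) (by positivity)
      (hu _ (by positivity)) (S.noise _ (by positivity)) ω hω0] with n h1 j hj
    calc _ ≤ _ := h1 j hj
      _ = _ := by
        rw [show C * (ω + ω⁻¹ * (ω ^ 2 / 2 + ω ^ 2 / 2)) = 2 * C * ω by field_simp; ring, hω]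
        field_simp

theorem bigO_rates (S : DescentSystem α γ u G h L c μ r) {m : ℝ} (hm1 : 1 < m) (hmr : m ≤ r)
    (hm : m * (2 - μ) ≤ 1) {s : ℕ → ℝ} (hs : ∀ n, s n ^ 2 ≤ 2 * (G n + h n)) :
    ∃ B > 0, (∀ᶠ n in atTop, |u n| ≤ B * γ n ^ (-(μ * m))) ∧
    (∀ᶠ n in atTop, G n ≤ B * γ n ^ (-(μ * m))) ∧
    (∀ᶠ n in atTop, ∀ j, n ≤ j → ∑ k ∈ Finset.Ico n j, α k * s k ≤ B * γ n ^ (1 - m)) := by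
  rcases hm.lt_or_eq with hm | hm
  · exact ⟨1, one_pos, S.littleO_rates hm1 hmr hm hs one_pos⟩
  have hm0 : 0 < m := by linarith
  have hμ := S.one_lt_mu
  have hμ2 := S.mu_le_two
  have hL := S.L_nonneg
  obtain ⟨K, hK, hup⟩ := S.upper_of_eq hm0 hmr hm
  have hu : ∀ᶠ n in atTop, |u n| ≤ K * γ n ^ (-(μ * m)) := by
    filter_upwards [hup, S.lower hm0 hmr hK] with n h1 h2
    exact abs_le'.2 ⟨h1, h2⟩
  have hG := S.gradient_le (p := μ * m) (by linarith) (by positivity) (by nlinarith) hK hu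
  obtain ⟨C, hC, hlen⟩ := S.exists_length_le hm1 hmr hm.le hs
  have hlen := hlen K hK 1 one_pos hu (S.noise 1 one_pos) 1 one_pos
  refine ⟨K + 6 * (L + 1) * K + C * (1 + 1⁻¹ * (K + 1)), by positivity, ?_, ?_, ?_⟩
  · filter_upwards [hu, S.clock.eventually_one_le] with n h1 h2
    refine h1.trans (mul_le_mul_of_nonneg_right ?_ (Real.rpow_nonneg (by linarith) _))
    have : 0 ≤ 6 * (L + 1) * K + C * (1 + 1⁻¹ * (K + 1)) := by positivity
    linarith
  · filter_upwards [hG, S.clock.eventually_one_le] with n h1 h2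
    refine h1.trans (mul_le_mul_of_nonneg_right ?_ (Real.rpow_nonneg (by linarith) _))
    have : 0 ≤ K + C * (1 + 1⁻¹ * (K + 1)) := by positivity
    linarith
  · filter_upwards [hlen, S.clock.eventually_one_le] with n h1 h2 j hj
    refine (h1 j hj).trans (mul_le_mul_of_nonneg_right ?_ (Real.rpow_nonneg (by linarith) _))
    have : 0 ≤ K + 6 * (L + 1) * K := by positivity
    linarith

end DescentSystem

/-! ### Perturbed gradient descent in an inner product space. -/

section Space

variable {E : Type*} [NormedAddCommGroup E]

/-- If `∑ α γ ^ r ξ` converges, the tails of `∑ α ξ` are `o(γ ^ (-r))`. -/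
theorem IsClock.exists_tail [NormedSpace ℝ E] [CompleteSpace E] {α γ : ℕ → ℝ}
    (h : IsClock α γ) {r : ℝ} (hr : 0 < r) {ξ : ℕ → E} {S : E}
    (hS : Tendsto (fun n => ∑ i ∈ Finset.range n, (α i * γ i ^ r) • ξ i) atTop (𝓝 S)) :
    ∃ w : ℕ → E, (∀ n, w (n + 1) = w n - α n • ξ n) ∧
      ∀ ε > 0, ∀ᶠ n in atTop, ‖w n‖ ≤ ε * γ n ^ (-r) := by
  set R : ℕ → E := fun n => S - ∑ i ∈ Finset.range n, (α i * γ i ^ r) • ξ i with hR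
  set X : ℕ → E := fun n => ∑ i ∈ Finset.range n, α i • ξ i with hX
  have hR0 : Tendsto R atTop (𝓝 0) := by
    have := hS.const_sub S
    rwa [sub_self] at this
  have hbd : ∀ ρ > 0, ∀ᶠ n in atTop, ∀ j, n ≤ j → ‖X j - X n‖ ≤ 2 * ρ * γ n ^ (-r) := by
    intro ρ hρ
    have h1 : ∀ᶠ n in atTop, ‖R n‖ ≤ ρ := by
      have := hR0.norm
      rw [norm_zero] at this
      exact this.eventually_le_const hρ
    obtain ⟨N, hN⟩ := eventually_atTop.1 (h1.and h.eventually_one_le)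
    filter_upwards [eventually_ge_atTop N] with n hn j hj
    -- Abel summation: the left side is the norm of `∑ (γ i ^ (-r) - γ (i + 1) ^ (-r)) • R (i + 1)`,
    -- whose weights are nonnegative and telescope.
    have key : ‖X j - X n + γ j ^ (-r) • R j - γ n ^ (-r) • R n‖ ≤
        ρ * (γ n ^ (-r) - γ j ^ (-r)) := by
      induction j, hj using Nat.le_induction with
      | base => simp
      | succ j hj ih =>
        have hg : 0 < γ j := zero_lt_one.trans_le (hN j (hn.trans hj)).2
        have h2 : α j • ξ j = γ j ^ (-r) • (R j - R (j + 1)) := by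
          simp only [hR, Finset.sum_range_succ]
          rw [show ∀ a b c : E, a - b - (a - (b + c)) = c by intro a b c; abel, smul_smul,
            ← mul_assoc, mul_comm (γ j ^ (-r)), mul_assoc, ← Real.rpow_add hg]
          simp
        have h3 : X (j + 1) - X n + γ (j + 1) ^ (-r) • R (j + 1) - γ n ^ (-r) • R n =
            (X j - X n + γ j ^ (-r) • R j - γ n ^ (-r) • R n) -
              (γ j ^ (-r) - γ (j + 1) ^ (-r)) • R (j + 1) := by
          simp only [hX, Finset.sum_range_succ, h2]
          rw [smul_sub, sub_smul]
          abel
        have h4 := h.rpow_neg_le j.le_succ hg hr.le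
        rw [h3]
        refine (norm_sub_le _ _).trans ?_
        rw [norm_smul, Real.norm_of_nonneg (sub_nonneg.2 h4)]
        have h5 := mul_le_mul_of_nonneg_left (hN (j + 1) (by omega)).1 (sub_nonneg.2 h4)
        linarith
    have hgn : 0 < γ n := zero_lt_one.trans_le (hN n hn).2
    have hgj : 0 < γ j := zero_lt_one.trans_le (hN j (hn.trans hj)).2
    have h6 : ∀ k, N ≤ k → ‖γ k ^ (-r) • R k‖ ≤ γ k ^ (-r) * ρ := by
      intro k hk
      have : 0 ≤ γ k ^ (-r) := Real.rpow_nonneg (zero_le_one.trans (hN k hk).2) _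
      rw [norm_smul, Real.norm_of_nonneg this]
      exact mul_le_mul_of_nonneg_left (hN k hk).1 this
    calc ‖X j - X n‖ = ‖(X j - X n + γ j ^ (-r) • R j - γ n ^ (-r) • R n) -
          (γ j ^ (-r) • R j - γ n ^ (-r) • R n)‖ := by congr 1; abel
      _ ≤ ρ * (γ n ^ (-r) - γ j ^ (-r)) + (γ j ^ (-r) * ρ + γ n ^ (-r) * ρ) :=
          (norm_sub_le _ _).trans (add_le_add key ((norm_sub_le _ _).trans
            (add_le_add (h6 j (hn.trans hj)) (h6 n hn))))
      _ = _ := by ring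
  have hcau : CauchySeq X := by
    rw [Metric.cauchySeq_iff']
    intro ε hε
    obtain ⟨N, hN1, hN2⟩ := ((hbd (ε / 4) (by positivity)).and h.eventually_one_le).exists
    refine ⟨N, fun n hn => ?_⟩
    have h1 : γ N ^ (-r) ≤ 1 := Real.rpow_le_one_of_one_le_of_nonpos hN2 (by linarith)
    rw [dist_eq_norm]
    have := hN1 n hn
    nlinarith
  obtain ⟨X', hX'⟩ := cauchySeq_tendsto_of_complete hcau
  refine ⟨fun n => X' - X n, fun n => ?_, fun ε hε => ?_⟩
  · simp only [hX, Finset.sum_range_succ]; abel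
  · filter_upwards [hbd (ε / 2) (by positivity)] with n hn
    refine le_of_tendsto (hX'.sub_const (X n)).norm
      (eventually_atTop.2 ⟨n, fun j hj => ?_⟩)
    have := hn j hj
    linarith

theorem LocallyLipschitz.exists_norm_sub_le_on_closedBall [ProperSpace E] {F : Type*}
    [NormedAddCommGroup F] {g : E → F} (hg : LocallyLipschitz g) (R : ℝ) :
    ∃ L ≥ 0, ∀ x ∈ Metric.closedBall (0 : E) R, ∀ y ∈ Metric.closedBall (0 : E) R,
      ‖g x - g y‖ ≤ L * ‖x - y‖ := by
  obtain ⟨L, hL⟩ := LocallyLipschitzOn.exists_lipschitzOnWith_of_compact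
    (isCompact_closedBall (0 : E) R) hg.locallyLipschitzOn
  exact ⟨L, L.2, fun x hx y hy => by simpa [dist_eq_norm] using hL.dist_le_mul x hx y hy⟩

theorem norm_add_sq_le (g e : E) : ‖g + e‖ ^ 2 ≤ 2 * (‖g‖ ^ 2 + ‖e‖ ^ 2) := by
  nlinarith [norm_add_le g e, norm_nonneg (g + e), sq_nonneg (‖g‖ - ‖e‖)]

variable [InnerProductSpace ℝ E] [CompleteSpace E]

/-- The mean value inequality for the derivative minus its value at `x`. It loses the factor `1 / 2`
of Taylor's formula, which is harmless here. -/
theorem abs_sub_sub_inner_gradient_le {f : E → ℝ} (hf : Differentiable ℝ f) {s : Set E}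
    (hs : Convex ℝ s) {L : ℝ} (hL : ∀ x ∈ s, ∀ y ∈ s, ‖gradient f x - gradient f y‖ ≤ L * ‖x - y‖)
    (hL0 : 0 ≤ L) {x y : E} (hx : x ∈ s) (hy : y ∈ s) :
    |f y - f x - inner ℝ (gradient f x) (y - x)| ≤ L * ‖y - x‖ ^ 2 := by
  have hseg := hs.segment_subset hx hy
  have := Convex.norm_image_sub_le_of_norm_hasFDerivWithin_le' (f := f)
    (f' := fun z => InnerProductSpace.toDual ℝ E (gradient f z)) (s := segment ℝ x y)
    (φ := InnerProductSpace.toDual ℝ E (gradient f x)) (C := L * ‖y - x‖)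
    (fun z _ => (hf z).hasGradientAt.hasFDerivAt.hasFDerivWithinAt) (fun z hz => ?_)
    (convex_segment x y) (left_mem_segment ℝ x y) (right_mem_segment ℝ x y)
  · rw [InnerProductSpace.toDual_apply_apply] at this
    rw [← Real.norm_eq_abs, sq, ← mul_assoc]
    exact this
  · rw [← map_sub, LinearIsometryEquiv.norm_map]
    refine (hL z (hseg hz) x hx).trans (mul_le_mul_of_nonneg_left ?_ hL0)
    exact norm_sub_le_of_mem_segment hz

/-- Bounded gradient descent with perturbations `e = o(γ ^ (-r))`. -/
structure PerturbedDescent (f : E → ℝ) (α γ : ℕ → ℝ) (r : ℝ) (R L : ℝ) (x e : ℕ → E) : Prop where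
  clock : IsClock α γ
  one_lt : 1 < r
  differentiable : Differentiable ℝ f
  L_nonneg : 0 ≤ L
  lipschitz : ∀ x ∈ Metric.closedBall (0 : E) R, ∀ y ∈ Metric.closedBall (0 : E) R,
    ‖gradient f x - gradient f y‖ ≤ L * ‖x - y‖
  mem_ball : ∀ n, x n ∈ Metric.closedBall (0 : E) R
  succ : ∀ n, x (n + 1) = x n - α n • (gradient f (x n) + e n)
  noise : ∀ ε > 0, ∀ᶠ n in atTop, ‖e n‖ ≤ ε * γ n ^ (-r)

namespace PerturbedDescent

variable {f : E → ℝ} {α γ : ℕ → ℝ} {r R L : ℝ} {x e : ℕ → E}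

/-- The second-order remainder is `O(α²)` and is absorbed by the first-order decrease as soon as `2
L α ≤ 1 / 4`. The cross term with `e` is split by Young's inequality. -/
theorem descent (S : PerturbedDescent f α γ r R L x e) :
    ∀ᶠ n in atTop, f (x (n + 1)) ≤
      f (x n) - α n / 2 * ‖gradient f (x n)‖ ^ 2 + 2 * α n * ‖e n‖ ^ 2 := by
  have h1 := (S.clock.tendsto_zero.const_mul (2 * L)).eventually_le_const
    (u := 1 / 4) (by norm_num)
  filter_upwards [h1] with n h1
  have h2 := (abs_le.1 (abs_sub_sub_inner_gradient_le S.differentiable (convex_closedBall 0 R)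
    S.lipschitz S.L_nonneg (S.mem_ball n) (S.mem_ball (n + 1)))).2
  have hα := S.clock.pos n
  rw [S.succ, sub_sub_cancel_left, inner_neg_right, inner_smul_right, norm_neg, norm_smul,
    inner_add_right, real_inner_self_eq_norm_sq, Real.norm_of_nonneg hα.le, mul_pow] at h2
  rw [S.succ]
  set g := gradient f (x n)
  have h3 : -inner ℝ g (e n) ≤ ‖g‖ ^ 2 / 4 + ‖e n‖ ^ 2 := by
    have := neg_le_of_abs_le (abs_real_inner_le_norm g (e n))
    nlinarith [sq_nonneg (‖g‖ / 2 - ‖e n‖)]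
  have h4 : L * (α n ^ 2 * ‖g + e n‖ ^ 2) ≤ α n * (1 / 4 * (‖g‖ ^ 2 + ‖e n‖ ^ 2)) := by
    calc L * (α n ^ 2 * ‖g + e n‖ ^ 2) ≤ L * (α n ^ 2 * (2 * (‖g‖ ^ 2 + ‖e n‖ ^ 2))) := by
          have := S.L_nonneg
          gcongr
          exact norm_add_sq_le _ _
      _ = α n * (2 * L * α n * (‖g‖ ^ 2 + ‖e n‖ ^ 2)) := by ring
      _ ≤ _ := by gcongr
  have h5 := mul_le_mul_of_nonneg_left h3 hα.le
  have h6 : 0 ≤ α n * ‖e n‖ ^ 2 := by positivity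
  linarith

theorem slow (S : PerturbedDescent f α γ r R L x e) (n : ℕ) :
    (1 - 3 * L * α n) * ‖gradient f (x n)‖ ^ 2 - 3 * L * α n * ‖e n‖ ^ 2 ≤
      ‖gradient f (x (n + 1))‖ ^ 2 := by
  have hα := S.clock.pos n
  have h1 := S.lipschitz _ (S.mem_ball n) _ (S.mem_ball (n + 1))
  rw [S.succ n, sub_sub_cancel, norm_smul, Real.norm_of_nonneg hα.le, ← S.succ n] at h1
  have h2 := norm_sub_norm_le (gradient f (x n)) (gradient f (x (n + 1)))
  set a := ‖gradient f (x n)‖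
  set b := ‖gradient f (x (n + 1))‖
  have ha : 0 ≤ a := norm_nonneg _
  have hb : 0 ≤ b := norm_nonneg _
  have hLα : 0 ≤ L * α n := mul_nonneg S.L_nonneg hα.le
  have h3 : a - L * α n * (a + ‖e n‖) ≤ b := by
    have := mul_le_mul_of_nonneg_left (norm_add_le (gradient f (x n)) (e n)) hLα
    linarith
  set d := L * α n * (a + ‖e n‖) with hd
  have hd0 : 0 ≤ d := mul_nonneg hLα (add_nonneg ha (norm_nonneg _))
  have h4 : a ^ 2 - 2 * a * d ≤ b ^ 2 := by
    rcases le_total a (2 * d) with h5 | h5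
    · nlinarith
    · nlinarith
  have h6 : 2 * a * d ≤ L * α n * (3 * a ^ 2 + ‖e n‖ ^ 2) := by
    calc 2 * a * d = L * α n * (2 * a * (a + ‖e n‖)) := by rw [hd]; ring
      _ ≤ _ := by
        gcongr
        nlinarith [sq_nonneg (a - ‖e n‖)]
  have h7 : 0 ≤ L * α n * ‖e n‖ ^ 2 := by positivity
  linarith

theorem noise_sq (S : PerturbedDescent f α γ r R L x e) {ε : ℝ} (hε : 0 < ε) :
    ∀ᶠ n in atTop, ‖e n‖ ^ 2 ≤ ε * γ n ^ (-(2 * r)) := by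
  filter_upwards [S.noise (√ε) (Real.sqrt_pos.2 hε), S.clock.eventually_one_le] with n h1 h2
  calc ‖e n‖ ^ 2 ≤ (√ε * γ n ^ (-r)) ^ 2 := by gcongr
    _ = _ := by
      rw [mul_pow, Real.sq_sqrt hε.le, ← Real.rpow_natCast, ← Real.rpow_mul (by linarith)]
      congr 2; push_cast; ring

/-- Since `∑ α ‖e‖²` is dominated by `∑ α γ ^ (-2 r) < ∞`, subtracting its partial sums turns `f (x
n)` into an eventually nonincreasing sequence, bounded below by compactness. -/
theorem exists_tendsto [ProperSpace E] (S : PerturbedDescent f α γ r R L x e) :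
    ∃ a, Tendsto (fun n => f (x n)) atTop (𝓝 a) := by
  have hsum : Summable fun n => α n * ‖e n‖ ^ 2 := by
    refine (S.clock.summable_mul_rpow_neg (m := 2 * r)
      (by linarith [S.one_lt])).of_norm_bounded_eventually_nat ?_
    filter_upwards [S.noise_sq one_pos] with n h1
    rw [Real.norm_of_nonneg (mul_nonneg (S.clock.pos n).le (sq_nonneg _))]
    have := (S.clock.pos n).le
    gcongr
    linarith
  have htail := hsum.hasSum.tendsto_sum_nat.const_mul 2
  set T := fun n => 2 * ∑ i ∈ Finset.range n, α i * ‖e i‖ ^ 2 with hT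
  obtain ⟨N, hN⟩ := eventually_atTop.1 S.descent
  have hanti : Antitone fun n => f (x (n + N)) - T (n + N) := by
    refine antitone_nat_of_succ_le fun n => ?_
    have h1 := hN (n + N) (Nat.le_add_left _ _)
    have h2 : 0 ≤ α (n + N) / 2 * ‖gradient f (x (n + N))‖ ^ 2 :=
      mul_nonneg (half_pos (S.clock.pos _)).le (sq_nonneg _)
    have h3 : T (n + 1 + N) = T (n + N) + 2 * (α (n + N) * ‖e (n + N)‖ ^ 2) := by
      simp only [hT]
      rw [add_right_comm, Finset.sum_range_succ, mul_add]
    rw [h3, add_right_comm n 1 N]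
    linarith
  have hbdd : BddBelow (Set.range fun n => f (x (n + N)) - T (n + N)) := by
    obtain ⟨l, hl⟩ := (isCompact_closedBall (0 : E) R).bddBelow_image
      S.differentiable.continuous.continuousOn
    refine ⟨l - 2 * ∑' i, α i * ‖e i‖ ^ 2, ?_⟩
    rintro _ ⟨n, rfl⟩
    have h1 : l ≤ f (x (n + N)) := hl ⟨_, S.mem_ball _, rfl⟩
    have h2 := hsum.sum_le_tsum (Finset.range (n + N))
      (fun i _ => mul_nonneg (S.clock.pos i).le (sq_nonneg _))
    simp only [hT]
    linarith
  have h1 := tendsto_atTop_ciInf hanti hbdd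
  have h2 := h1.add ((tendsto_add_atTop_iff_nat N).2 htail)
  exact ⟨_, (tendsto_add_atTop_iff_nat N).1 (h2.congr fun n => by simp [hT])⟩

theorem exists_descentSystem (S : PerturbedDescent f α γ r R L x e) {a μ M : ℝ}
    (ha : Tendsto (fun n => f (x n)) atTop (𝓝 a)) (hμ : μ ∈ Set.Ioc (1 : ℝ) 2)
    (hM : 0 < M) (hloj : ∀ᶠ n in atTop, |f (x n) - a| ≤ M * ‖gradient f (x n)‖ ^ μ) :
    ∃ c, DescentSystem α γ (fun n => f (x n) - a) (fun n => ‖gradient f (x n)‖ ^ 2)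
      (fun n => ‖e n‖ ^ 2) (3 * L) c μ r := by
  have hμ0 : 0 < μ := by linarith [hμ.1]
  refine ⟨(M ^ (2 / μ))⁻¹, S.clock,
    mul_nonneg (by norm_num) S.L_nonneg, by positivity, hμ.1, hμ.2, ?_,
    Eventually.of_forall S.slow, fun ε hε => S.noise_sq hε, ?_, ?_⟩
  · filter_upwards [S.descent] with n h1
    linarith
  · simpa using ha.sub_const a
  · filter_upwards [hloj] with n h1
    rw [inv_mul_le_iff₀ (by positivity)]
    calc |f (x n) - a| ^ (2 / μ) ≤ (M * ‖gradient f (x n)‖ ^ μ) ^ (2 / μ) :=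
          Real.rpow_le_rpow (abs_nonneg _) h1 (by positivity)
      _ = _ := by
        rw [Real.mul_rpow hM.le (by positivity), ← Real.rpow_mul (norm_nonneg _),
          mul_div_cancel₀ _ hμ0.ne']
        norm_cast

theorem norm_sub_le_sum (S : PerturbedDescent f α γ r R L x e) {n j : ℕ} (hj : n ≤ j) :
    ‖x j - x n‖ ≤ ∑ k ∈ Finset.Ico n j, α k * ‖gradient f (x k) + e k‖ := by
  have := dist_le_Ico_sum_dist x hj
  rw [dist_comm, dist_eq_norm] at this
  refine this.trans (Finset.sum_le_sum fun k _ => ?_)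
  rw [dist_eq_norm, S.succ, sub_sub_cancel, norm_smul, Real.norm_of_nonneg (S.clock.pos k).le]

theorem norm_sub_limit_le (S : PerturbedDescent f α γ r R L x e) {y : E}
    (hy : Tendsto x atTop (𝓝 y)) {b : ℝ} {n : ℕ}
    (hb : ∀ j, n ≤ j → ∑ k ∈ Finset.Ico n j, α k * ‖gradient f (x k) + e k‖ ≤ b) :
    ‖x n - y‖ ≤ b := by
  rw [norm_sub_rev]
  exact le_of_tendsto (hy.sub_const (x n)).norm
    (eventually_atTop.2 ⟨n, fun j hj => (S.norm_sub_le_sum hj).trans (hb j hj)⟩)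

/-- The smaller of `r` and `1 / (2 - μ)` is an admissible rate exponent. -/
theorem exists_exponent (hr : 1 < r) {μ : ℝ} (hμ : μ ∈ Set.Ioc (1 : ℝ) 2) :
    ∃ m, 1 < m ∧ m ≤ r ∧ m * (2 - μ) ≤ 1 := by
  obtain ⟨h1, h2⟩ := hμ
  rcases le_or_gt (r * (2 - μ)) 1 with h | h
  · exact ⟨r, hr, le_rfl, h⟩
  · have h3 : 0 < 2 - μ := by
      by_contra! h4
      nlinarith
    refine ⟨1 / (2 - μ), ?_, ?_, ?_⟩
    · rw [lt_div_iff₀ h3]; linarith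
    · rw [div_le_iff₀ h3]; exact h.le
    · rw [one_div_mul_cancel h3.ne']

/-- The Łojasiewicz inequality on the whole ball, at the level `a = lim f (x n)`, needs only values
of `f` near `a`, so it applies before any limit point is known. Some rate exponent `m > 1` is
available, which makes the path Cauchy. -/
theorem exists_limit [ProperSpace E] (S : PerturbedDescent f α γ r R L x e)
    (hgrad : Continuous (gradient f))
    (hloj : ∀ a ∈ f '' Metric.closedBall (0 : E) R, ∃ δ ∈ Set.Ioc (0 : ℝ) 1,
      ∃ μ ∈ Set.Ioc (1 : ℝ) 2, ∃ M ∈ Set.Ici (1 : ℝ), ∀ t ∈ Metric.closedBall (0 : E) R,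
        |f t - a| ≤ δ → |f t - a| ≤ M * ‖gradient f t‖ ^ μ) :
    ∃ y, Tendsto x atTop (𝓝 y) ∧ gradient f y = 0 := by
  obtain ⟨a, ha⟩ := S.exists_tendsto
  have hmem : a ∈ f '' Metric.closedBall (0 : E) R :=
    ((isCompact_closedBall (0 : E) R).image S.differentiable.continuous).isClosed.mem_of_tendsto
      ha (Eventually.of_forall fun n => ⟨_, S.mem_ball n, rfl⟩)
  obtain ⟨δ, hδ, μ, hμ, M, hM, hl⟩ := hloj a hmem
  have h1 : ∀ᶠ n in atTop, |f (x n) - a| ≤ δ := by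
    have := (ha.sub_const a).abs
    rw [sub_self, abs_zero] at this
    exact this.eventually_le_const hδ.1
  obtain ⟨c, D⟩ := S.exists_descentSystem ha hμ (zero_lt_one.trans_le hM)
    (h1.mono fun n hn => hl _ (S.mem_ball n) hn)
  obtain ⟨m, hm1, hmr, hm⟩ := exists_exponent S.one_lt hμ
  obtain ⟨B, hB, -, hG, hlen⟩ := D.bigO_rates hm1 hmr hm
    (s := fun n => ‖gradient f (x n) + e n‖) fun n => norm_add_sq_le _ _
  have hcau : CauchySeq x := by
    rw [Metric.cauchySeq_iff']
    intro ε hε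
    have h2 := ((S.clock.tendsto_rpow_neg (a := m - 1) (by linarith)).const_mul B).eventually_lt_const
      (u := ε) (by simpa using hε)
    obtain ⟨N, hN1, hN2⟩ := (hlen.and h2).exists
    refine ⟨N, fun n hn => ?_⟩
    rw [dist_eq_norm]
    refine ((S.norm_sub_le_sum hn).trans (hN1 n hn)).trans_lt ?_
    rwa [neg_sub] at hN2
  obtain ⟨y, hy⟩ := cauchySeq_tendsto_of_complete hcau
  refine ⟨y, hy, ?_⟩
  have h3 : Tendsto (fun n => ‖gradient f (x n)‖ ^ 2) atTop (𝓝 (‖gradient f y‖ ^ 2)) :=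
    (((hgrad.tendsto y).comp hy).norm).pow 2
  have h4 : Tendsto (fun n => B * γ n ^ (-(μ * m))) atTop (𝓝 (B * 0)) :=
    (S.clock.tendsto_rpow_neg (mul_pos (by linarith [hμ.1]) (by linarith))).const_mul B
  rw [mul_zero] at h4
  have h5 := le_of_tendsto_of_tendsto h3 h4 hG
  have h6 : ‖gradient f y‖ = 0 := by nlinarith [norm_nonneg (gradient f y)]
  exact norm_eq_zero.1 h6

end PerturbedDescent

end Space

/-! ### Removal of the noise by a shift, and rates for the original sequence. -/

section Space

variable {E : Type*} [NormedAddCommGroup E] [InnerProductSpace ℝ E] [CompleteSpace E]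

/-- A gradient search with noise `ξ` for which `∑ α γ ^ r ξ` converges is, up to a small shift `w`,
a perturbed descent. -/
theorem exists_perturbedDescent [ProperSpace E] {f : E → ℝ} {α γ : ℕ → ℝ} {r : ℝ}
    (hclock : IsClock α γ) (hr : 1 < r) (hf : Differentiable ℝ f)
    (hgrad : LocallyLipschitz (gradient f)) {θ ξ : ℕ → E}
    (hrec : ∀ n, θ (n + 1) = θ n - α n • (gradient f (θ n) + ξ n))
    (hbdd : BddAbove (Set.range fun n => ‖θ n‖)) {s : E}
    (hs : Tendsto (fun n => ∑ i ∈ Finset.range n, (α i * γ i ^ r) • ξ i) atTop (𝓝 s)) :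
    ∃ (R L : ℝ) (w : ℕ → E), (∀ n, θ n ∈ Metric.closedBall (0 : E) R) ∧
      (∀ ε > 0, ∀ᶠ n in atTop, ‖w n‖ ≤ ε * γ n ^ (-r)) ∧
      PerturbedDescent f α γ r R L (fun n => θ n - w n)
        (fun n => gradient f (θ n) - gradient f (θ n - w n)) := by
  obtain ⟨w, hw, hw0⟩ := hclock.exists_tail (by linarith) hs
  have hw1 : Tendsto (fun n => ‖w n‖) atTop (𝓝 0) := by
    refine squeeze_zero' (Eventually.of_forall fun n => norm_nonneg _) (hw0 1 one_pos) ?_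
    simpa using (hclock.tendsto_rpow_neg (a := r) (by linarith)).const_mul 1
  obtain ⟨R₁, hR₁⟩ := hbdd
  obtain ⟨R₂, hR₂⟩ := hw1.bddAbove_range
  have h1 : ∀ n, ‖θ n‖ ≤ R₁ := fun n => hR₁ ⟨n, rfl⟩
  have h2 : ∀ n, ‖w n‖ ≤ R₂ := fun n => hR₂ ⟨n, rfl⟩
  have h20 : 0 ≤ R₂ := (norm_nonneg _).trans (h2 0)
  obtain ⟨L, hL0, hL⟩ := hgrad.exists_norm_sub_le_on_closedBall (R₁ + R₂)
  have hθ : ∀ n, θ n ∈ Metric.closedBall (0 : E) (R₁ + R₂) := fun n => by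
    rw [mem_closedBall_zero_iff]; linarith [h1 n]
  have hx : ∀ n, θ n - w n ∈ Metric.closedBall (0 : E) (R₁ + R₂) := fun n => by
    rw [mem_closedBall_zero_iff]
    exact (norm_sub_le _ _).trans (add_le_add (h1 n) (h2 n))
  -- The ball of radius `R₁ + R₂` contains both sequences, so a single Lipschitz constant controls
  -- `e` by `L ‖w‖`.
  refine ⟨R₁ + R₂, L, w, hθ, hw0, hclock, hr, hf, hL0, hL, hx, fun n => ?_, fun ε hε => ?_⟩
  · rw [hrec, hw, add_sub_cancel, smul_add]; abel
  · filter_upwards [hw0 (ε / (L + 1)) (by positivity), hclock.eventually_one_le] with n h3 h4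
    have h5 := hL _ (hθ n) _ (hx n)
    rw [sub_sub_cancel] at h5
    have h6 : 0 ≤ ε / (L + 1) * γ n ^ (-r) := (norm_nonneg _).trans h3
    calc _ ≤ L * ‖w n‖ := h5
      _ ≤ (L + 1) * (ε / (L + 1) * γ n ^ (-r)) := by gcongr; linarith
      _ = _ := by field_simp

/-- Undoing the shift preserves the rates. For `f` a Lipschitz estimate would only give `γ ^ (-r)`;
the first-order expansion has error `‖∇f‖ ‖w‖ + L ‖w‖²`, with both factors of order `γ ^ (-p / 2)`.
The bounds are linear in `B`, so they serve for big-O and little-o alike. -/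
theorem PerturbedDescent.shifted_bounds {f : E → ℝ} {α γ : ℕ → ℝ} {r R L m p : ℝ} {θ w : ℕ → E}
    (S : PerturbedDescent f α γ r R L (fun n => θ n - w n)
      (fun n => gradient f (θ n) - gradient f (θ n - w n)))
    (hθ : ∀ n, θ n ∈ Metric.closedBall (0 : E) R)
    (hw : ∀ ε > 0, ∀ᶠ n in atTop, ‖w n‖ ≤ ε * γ n ^ (-r)) {y : E}
    (hy : Tendsto (fun n => θ n - w n) atTop (𝓝 y)) (hp : p ≤ 2 * r) (hm : m ≤ r)
    {B : ℝ} (hB : 0 < B)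
    (hu : ∀ᶠ n in atTop, |f (θ n - w n) - f y| ≤ B * γ n ^ (-p))
    (hG : ∀ᶠ n in atTop, ‖gradient f (θ n - w n)‖ ^ 2 ≤ B * γ n ^ (-p))
    (hlen : ∀ᶠ n in atTop, ∀ j, n ≤ j → ∑ k ∈ Finset.Ico n j, α k *
      ‖gradient f (θ k - w k) + (gradient f (θ k) - gradient f (θ k - w k))‖ ≤
        B * γ n ^ (1 - m)) :
    ∀ᶠ n in atTop, ‖gradient f (θ n)‖ ^ 2 ≤ (4 + L) * B * γ n ^ (-p) ∧
      |f (θ n) - f y| ≤ (4 + L) * B * γ n ^ (-p) ∧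
      ‖θ n - y‖ ≤ (4 + L) * B * γ n ^ (-(m - 1)) := by
  filter_upwards [hu, hG, hlen, S.noise_sq hB, hw (√B) (Real.sqrt_pos.2 hB), hw B hB,
    S.clock.eventually_one_le] with n h1 h2 h3 h4 h5 h6 h7
  have hγ : 0 ≤ γ n := by linarith
  have hL := S.L_nonneg
  have h8 : γ n ^ (-(2 * r)) ≤ γ n ^ (-p) := Real.rpow_le_rpow_of_exponent_le h7 (by linarith)
  have h9 : γ n ^ (-r) ≤ γ n ^ (1 - m) := Real.rpow_le_rpow_of_exponent_le h7 (by linarith)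
  have hX : 0 ≤ B * γ n ^ (-p) := mul_nonneg hB.le (Real.rpow_nonneg hγ _)
  have hY : 0 ≤ B * γ n ^ (1 - m) := mul_nonneg hB.le (Real.rpow_nonneg hγ _)
  have h4' := h4.trans (mul_le_mul_of_nonneg_left h8 hB.le)
  have h5' : ‖w n‖ ^ 2 ≤ B * γ n ^ (-p) := by
    calc ‖w n‖ ^ 2 ≤ (√B * γ n ^ (-r)) ^ 2 := by gcongr
      _ = B * γ n ^ (-(2 * r)) := by
        rw [mul_pow, Real.sq_sqrt hB.le, ← Real.rpow_natCast, ← Real.rpow_mul hγ]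
        congr 2; push_cast; ring
      _ ≤ _ := mul_le_mul_of_nonneg_left h8 hB.le
  have h6' := h6.trans (mul_le_mul_of_nonneg_left h9 hB.le)
  refine ⟨?_, ?_, ?_⟩
  · have h10 := norm_add_sq_le (gradient f (θ n - w n))
      (gradient f (θ n) - gradient f (θ n - w n))
    rw [add_sub_cancel] at h10
    have : 0 ≤ L * (B * γ n ^ (-p)) := by positivity
    linarith
  · have h10 := abs_sub_sub_inner_gradient_le S.differentiable (convex_closedBall 0 R)
      S.lipschitz hL (S.mem_ball n) (hθ n)
    rw [sub_sub_cancel] at h10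
    have h11 := abs_real_inner_le_norm (gradient f (θ n - w n)) (w n)
    have h12 : ‖gradient f (θ n - w n)‖ * ‖w n‖ ≤ B * γ n ^ (-p) := by
      nlinarith [sq_nonneg (‖gradient f (θ n - w n)‖ - ‖w n‖)]
    have h13 := mul_le_mul_of_nonneg_left h5' hL
    have h14 : |f (θ n) - f y| ≤ |f (θ n) - f (θ n - w n) - inner ℝ (gradient f (θ n - w n)) (w n)|
        + |inner ℝ (gradient f (θ n - w n)) (w n)| + |f (θ n - w n) - f y| := by
      refine le_trans (le_of_eq ?_) (abs_add_three _ _ _)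
      congr 1; ring
    linarith
  · have h10 := S.norm_sub_limit_le hy h3
    have h11 : ‖θ n - y‖ ≤ ‖θ n - w n - y‖ + ‖w n‖ := by
      refine le_trans (le_of_eq ?_) (norm_add_le _ _)
      congr 1; abel
    have : 0 ≤ L * (B * γ n ^ (1 - m)) := by positivity
    rw [neg_sub]
    linarith

/-- Convergence of gradient search under the Łojasiewicz condition, and rates of convergence. -/
theorem gradient_search_rates [ProperSpace E] {f : E → ℝ} {α γ : ℕ → ℝ} {r : ℝ}
    (hclock : IsClock α γ) (hr : 1 < r) (hf : Differentiable ℝ f)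
    (hgrad : LocallyLipschitz (gradient f))
    (hloj : ∀ Q : Set E, IsCompact Q → ∀ a ∈ f '' Q, ∃ δ ∈ Set.Ioc (0 : ℝ) 1,
      ∃ μ ∈ Set.Ioc (1 : ℝ) 2, ∃ M ∈ Set.Ici (1 : ℝ), ∀ t ∈ Q,
        |f t - a| ≤ δ → |f t - a| ≤ M * ‖gradient f t‖ ^ μ) {θ ξ : ℕ → E}
    (hrec : ∀ n, θ (n + 1) = θ n - α n • (gradient f (θ n) + ξ n))
    (hbdd : BddAbove (Set.range fun n => ‖θ n‖)) {s : E}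
    (hs : Tendsto (fun n => ∑ i ∈ Finset.range n, (α i * γ i ^ r) • ξ i) atTop (𝓝 s)) :
    ∃ y, Tendsto θ atTop (𝓝 y) ∧ gradient f y = 0 ∧
      ∀ δ > 0, ∀ μ ∈ Set.Ioc (1 : ℝ) 2, ∀ M > 0,
        (∀ t, ‖t - y‖ ≤ δ → |f t - f y| ≤ M * ‖gradient f t‖ ^ μ) → ∀ m, 1 < m → m ≤ r →
        (m * (2 - μ) ≤ 1 →
          (fun n => ‖gradient f (θ n)‖ ^ 2) =O[atTop] (fun n => γ n ^ (-(μ * m))) ∧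
          (fun n => |f (θ n) - f y|) =O[atTop] (fun n => γ n ^ (-(μ * m))) ∧
          (fun n => ‖θ n - y‖) =O[atTop] (fun n => γ n ^ (-(m - 1)))) ∧
        (m * (2 - μ) < 1 →
          (fun n => ‖gradient f (θ n)‖ ^ 2) =o[atTop] (fun n => γ n ^ (-(μ * m))) ∧
          (fun n => |f (θ n) - f y|) =o[atTop] (fun n => γ n ^ (-(μ * m))) ∧
          (fun n => ‖θ n - y‖) =o[atTop] (fun n => γ n ^ (-(m - 1)))) := by
  obtain ⟨R, L, w, hθ, hw, S⟩ := exists_perturbedDescent hclock hr hf hgrad hrec hbdd hs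
  obtain ⟨y, hy, hy0⟩ := S.exists_limit hgrad.continuous (hloj _ (isCompact_closedBall 0 R))
  have hw0 : Tendsto w atTop (𝓝 0) := by
    rw [tendsto_zero_iff_norm_tendsto_zero]
    refine squeeze_zero' (Eventually.of_forall fun n => norm_nonneg _) (hw 1 one_pos) ?_
    simpa using (hclock.tendsto_rpow_neg (a := r) (by linarith)).const_mul 1
  have hθy : Tendsto θ atTop (𝓝 y) := by simpa using hy.add hw0
  refine ⟨y, hθy, hy0, fun δ hδ μ hμ M hM hl m hm1 hmr => ?_⟩
  have hnear : ∀ᶠ n in atTop, ‖(θ n - w n) - y‖ ≤ δ := by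
    have := (hy.sub_const y).norm
    rw [sub_self, norm_zero] at this
    exact this.eventually_le_const hδ
  -- Second use of Łojasiewicz, now with constants valid near the limit `y`.
  obtain ⟨c, D⟩ := S.exists_descentSystem ((hf.continuous.tendsto y).comp hy) hμ hM
    (hnear.mono fun n hn => hl _ hn)
  have hsq := fun n => norm_add_sq_le (gradient f (θ n - w n))
    (gradient f (θ n) - gradient f (θ n - w n))
  have hp : μ * m ≤ 2 * r := by nlinarith [hμ.1, hμ.2]
  have hL := S.L_nonneg
  have hnn : ∀ a : ℝ, ∀ᶠ n in atTop, 0 ≤ γ n ^ a :=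
    fun a => hclock.eventually_one_le.mono fun n hn => Real.rpow_nonneg (by linarith) _
  have hof : ∀ {g b : ℕ → ℝ} {C : ℝ}, (∀ᶠ n in atTop, 0 ≤ b n) → (∀ n, 0 ≤ g n) →
      (∀ᶠ n in atTop, g n ≤ C * b n) → ∀ᶠ n in atTop, ‖g n‖ ≤ C * ‖b n‖ := by
    intro g b C hb hg h
    filter_upwards [hb, h] with n h1 h2
    rwa [Real.norm_of_nonneg h1, Real.norm_of_nonneg (hg n)]
  constructor
  · intro hm
    obtain ⟨B, hB, hu, hG, hlen⟩ := D.bigO_rates hm1 hmr hm hsq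
    have key := S.shifted_bounds hθ hw hy hp hmr hB hu hG hlen
    exact ⟨.of_bound _ (hof (hnn _) (fun n => sq_nonneg _) (key.mono fun n hn => hn.1)),
      .of_bound _ (hof (hnn _) (fun n => abs_nonneg _) (key.mono fun n hn => hn.2.1)),
      .of_bound _ (hof (hnn _) (fun n => norm_nonneg _) (key.mono fun n hn => hn.2.2))⟩
  · intro hm
    have key : ∀ ε > (0 : ℝ), _ := fun (ε : ℝ) (hε : 0 < ε) => by
      have hε' : 0 < ε / (4 + L) := by positivity
      obtain ⟨hu, hG, hlen⟩ := D.littleO_rates hm1 hmr hm hsq hε'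
      have := S.shifted_bounds hθ hw hy hp hmr hε' hu hG hlen
      rwa [mul_div_cancel₀ ε (by positivity : 4 + L ≠ 0)] at this
    exact ⟨.of_bound fun ε hε => hof (hnn _) (fun n => sq_nonneg _)
        ((key ε hε).mono fun n hn => hn.1),
      .of_bound fun ε hε => hof (hnn _) (fun n => abs_nonneg _)
        ((key ε hε).mono fun n hn => hn.2.1),
      .of_bound fun ε hε => hof (hnn _) (fun n => norm_nonneg _)
        ((key ε hε).mono fun n hn => hn.2.2)⟩

end Space

/-! ### Conditional expectations computed by transition kernels. -/

section Conditioning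

variable {Ω Ω' S : Type*} {mΩ : MeasurableSpace Ω} {mΩ' : MeasurableSpace Ω'}
  [MeasurableSpace S] [StandardBorelSpace S] [Nonempty S]

/-- A family of probability measures giving the conditional probabilities of each measurable set is
the regular conditional distribution, up to a null set. -/
theorem condDistrib_ae_eq_of_forall_condExp {P : Measure Ω} [IsProbabilityMeasure P] {X : Ω → Ω'}
    {Y : Ω → S} (hX : Measurable X) (hY : Measurable Y) {κ : Ω → Measure S}
    (hκ : ∀ ω, IsProbabilityMeasure (κ ω))
    (h : ∀ B, MeasurableSet B → P⟦Y ⁻¹' B | mΩ'.comap X⟧ =ᵐ[P] fun ω => (κ ω).real B) :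
    ∀ᵐ ω ∂P, condDistrib Y X P (X ω) = κ ω := by
  -- A countable algebra generating the σ-algebra leaves only countably many null sets to discard,
  -- and it determines a probability measure.
  obtain ⟨b, hbc, hb⟩ := MeasurableSpace.CountablyGenerated.isCountablyGenerated (α := S)
  have hgen : ‹MeasurableSpace S› = MeasurableSpace.generateFrom (generateSetAlgebra b) := by
    rw [generateFrom_generateSetAlgebra_eq, hb]
  have hmeas : ∀ s ∈ generateSetAlgebra b, MeasurableSet s := fun s hs => by
    rw [hgen]; exact MeasurableSpace.measurableSet_generateFrom hs
  have hall : ∀ᵐ ω ∂P, ∀ s ∈ generateSetAlgebra b,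
      (condDistrib Y X P (X ω)).real s = (κ ω).real s := by
    rw [ae_ball_iff (countable_generateSetAlgebra hbc)]
    intro s hs
    filter_upwards [condDistrib_ae_eq_condExp (μ := P) hX hY (hmeas s hs), h s (hmeas s hs)]
      with ω h1 h2
    rw [h1, h2]
  filter_upwards [hall] with ω hω
  have := hκ ω
  refine ext_of_generate_finite _ hgen
    isSetAlgebra_generateSetAlgebra.isSetRing.isSetSemiring.isPiSystem (fun s hs => ?_) (by simp)
  have h1 := hω s hs
  rwa [measureReal_eq_measureReal_iff] at h1

theorem condExp_ae_eq_integral_of_forall_condExp {F : Type*} [NormedAddCommGroup F]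
    [NormedSpace ℝ F] [CompleteSpace F] {P : Measure Ω} [IsProbabilityMeasure P] {X : Ω → Ω'}
    {Y : Ω → S} (hX : Measurable X) (hY : Measurable Y) {κ : Ω → Measure S}
    (hκ : ∀ ω, IsProbabilityMeasure (κ ω))
    (h : ∀ B, MeasurableSet B → P⟦Y ⁻¹' B | mΩ'.comap X⟧ =ᵐ[P] fun ω => (κ ω).real B)
    {g : Ω' → S → F} (hg : StronglyMeasurable (Function.uncurry g))
    (hint : Integrable (fun ω => g (X ω) (Y ω)) P) :
    P[fun ω => g (X ω) (Y ω) | mΩ'.comap X] =ᵐ[P] fun ω => ∫ y, g (X ω) y ∂(κ ω) := by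
  filter_upwards [condExp_prod_ae_eq_integral_condDistrib hX hY.aemeasurable hg hint,
    condDistrib_ae_eq_of_forall_condExp hX hY hκ h] with ω h1 h2
  rw [← h2]
  exact h1

/-- Conditional expectation given a sub-σ-algebra, computed by a family of probability measures
that gives the conditional probabilities. -/
theorem condExp_ae_eq_integral_of_le {F : Type*} [NormedAddCommGroup F]
    [NormedSpace ℝ F] [CompleteSpace F] {P : Measure Ω} [IsProbabilityMeasure P]
    {m : MeasurableSpace Ω} (hm : m ≤ mΩ)
    {Y : Ω → S} (hY : Measurable[mΩ] Y) {κ : Ω → Measure S}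
    (hκ : ∀ ω, IsProbabilityMeasure (κ ω))
    (h : ∀ B, MeasurableSet B → P⟦Y ⁻¹' B | m⟧ =ᵐ[P] fun ω => (κ ω).real B)
    {g : Ω → S → F} (hg : StronglyMeasurable[m.prod inferInstance] (Function.uncurry g))
    (hint : Integrable (fun ω => g ω (Y ω)) P) :
    P[fun ω => g ω (Y ω) | m] =ᵐ[P] fun ω => ∫ y, g ω y ∂(κ ω) := by
  have hid : Measurable[mΩ, m] (id : Ω → Ω) := fun s hs => hm s hs
  have hcomap : m.comap (id : Ω → Ω) = m := MeasurableSpace.comap_id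
  have := @condExp_ae_eq_integral_of_forall_condExp Ω Ω S mΩ m _ _ _ F _ _ _ P _ id Y hid hY κ hκ
    (by rwa [hcomap]) g hg hint
  rwa [hcomap] at this

end Conditioning

/-! ### Convergence of L² martingales. -/

section Martingale

variable {Ω : Type*} {mΩ : MeasurableSpace Ω} {P : Measure Ω} [IsProbabilityMeasure P]

/-- A series of square integrable martingale differences with summable second moments converges. -/
theorem ae_exists_tendsto_sum_of_condExp_eq_zero {ℱ : Filtration ℕ mΩ} {d : ℕ → Ω → ℝ}
    (hmeas : ∀ n, StronglyMeasurable[ℱ (n + 1)] (d n)) (hL2 : ∀ n, MemLp (d n) 2 P)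
    (hcond : ∀ n, P[d n | ℱ n] =ᵐ[P] 0) (hsum : Summable fun n => ∫ ω, d n ω ^ 2 ∂P) :
    ∀ᵐ ω ∂P, ∃ c, Tendsto (fun n => ∑ i ∈ Finset.range n, d i ω) atTop (𝓝 c) := by
  set M : ℕ → Ω → ℝ := fun n ω => ∑ i ∈ Finset.range n, d i ω with hM
  have hsucc : ∀ n, M (n + 1) = M n + d n := fun n => by
    ext ω; simp [hM, Finset.sum_range_succ]
  have hML2 : ∀ n, MemLp (M n) 2 P := fun n => memLp_finsetSum _ fun i _ => hL2 i
  have hMint : ∀ n, Integrable (M n) P := fun n => (hML2 n).integrable one_le_two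
  have hMmeas : ∀ n, StronglyMeasurable[ℱ n] (M n) := fun n =>
    Finset.stronglyMeasurable_fun_sum _ fun i hi =>
      (hmeas i).mono (ℱ.mono (Finset.mem_range.1 hi))
  have hmart : Martingale M ℱ P := by
    refine martingale_nat hMmeas hMint fun n => ?_
    rw [hsucc]
    have h1 := condExp_add (μ := P) (m := ℱ n) (hMint n) ((hL2 n).integrable one_le_two)
    filter_upwards [h1, hcond n] with ω h2 h3
    rw [h2, Pi.add_apply, h3, condExp_of_stronglyMeasurable (ℱ.le n) (hMmeas n) (hMint n)]
    simp
  -- Orthogonality of the increments; the resulting L² bound gives the L¹ bound for Doob's theorem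
  -- via `|x| ≤ 1 + x²`.
  have hsq : ∀ n, ∫ ω, M n ω ^ 2 ∂P ≤ ∑' n, ∫ ω, d n ω ^ 2 ∂P := by
    intro n
    have hdnn : ∀ n, 0 ≤ ∫ ω, d n ω ^ 2 ∂P := fun n => integral_nonneg fun ω => sq_nonneg _
    suffices h : ∫ ω, M n ω ^ 2 ∂P = ∑ i ∈ Finset.range n, ∫ ω, d i ω ^ 2 ∂P by
      rw [h]; exact hsum.sum_le_tsum _ fun i _ => hdnn i
    induction n with
    | zero => simp [hM]
    | succ n ih =>
      have hprod : Integrable (M n * d n) P := (hML2 n).integrable_mul (hL2 n)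
      have hzero : ∫ ω, (M n * d n) ω ∂P = 0 := by
        rw [← integral_condExp (ℱ.le n)]
        have h1 := condExp_mul_of_stronglyMeasurable_left (hMmeas n) hprod
          ((hL2 n).integrable one_le_two)
        rw [integral_congr_ae (g := 0)]
        · simp
        · filter_upwards [h1, hcond n] with ω h2 h3
          rw [h2, Pi.mul_apply, h3]; simp
      rw [Finset.sum_range_succ, ← ih]
      have h2 : ∀ ω, M (n + 1) ω ^ 2 = M n ω ^ 2 + 2 * (M n * d n) ω + d n ω ^ 2 := fun ω => by
        rw [hsucc]; simp only [Pi.add_apply, Pi.mul_apply]; ring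
      simp_rw [h2]
      rw [integral_add (f := fun ω => M n ω ^ 2 + 2 * (M n * d n) ω)
          ((hML2 n).integrable_sq.add (hprod.const_mul 2)) (hL2 n).integrable_sq,
        integral_add (hML2 n).integrable_sq (hprod.const_mul 2), integral_const_mul, hzero]
      ring
  refine hmart.submartingale.exists_ae_tendsto_of_bdd
    (R := (1 + ∑' n, ∫ ω, d n ω ^ 2 ∂P).toNNReal) fun n => ?_
  rw [eLpNorm_one_eq_lintegral_enorm, ← ofReal_integral_norm_eq_lintegral_enorm (hMint n)]
  refine ENNReal.ofReal_le_ofReal ?_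
  calc ∫ ω, ‖M n ω‖ ∂P ≤ ∫ ω, (1 + M n ω ^ 2) ∂P := by
        refine integral_mono (hMint n).norm ((integrable_const 1).add (hML2 n).integrable_sq)
          fun ω => ?_
        simp only [Real.norm_eq_abs]
        nlinarith [sq_nonneg (|M n ω| - 1), sq_abs (M n ω), abs_nonneg (M n ω)]
    _ = 1 + ∫ ω, M n ω ^ 2 ∂P := by
        rw [integral_add (integrable_const 1) (hML2 n).integrable_sq]; simp
    _ ≤ _ := by linarith [hsq n]

/-- The vector-valued version of `ae_exists_tendsto_sum_of_condExp_eq_zero`. -/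
theorem ae_exists_tendsto_sum_of_condExp_eq_zero_eucl {k : ℕ} {ℱ : Filtration ℕ mΩ}
    {d : ℕ → Ω → Eucl k}
    (hmeas : ∀ n, StronglyMeasurable[ℱ (n + 1)] (d n)) (hL2 : ∀ n, MemLp (d n) 2 P)
    (hcond : ∀ n, P[d n | ℱ n] =ᵐ[P] 0) (hsum : Summable fun n => ∫ ω, ‖d n ω‖ ^ 2 ∂P) :
    ∀ᵐ ω ∂P, ∃ c, Tendsto (fun n => ∑ i ∈ Finset.range n, d i ω) atTop (𝓝 c) := by
  have hcoord : ∀ i : Fin k, ∀ᵐ ω ∂P, ∃ c,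
      Tendsto (fun n => ∑ j ∈ Finset.range n, d j ω i) atTop (𝓝 c) := by
    intro i
    have hL2i : ∀ n, MemLp (fun ω => d n ω i) 2 P := fun n =>
      (EuclideanSpace.proj (𝕜 := ℝ) i).comp_memLp' (hL2 n)
    refine ae_exists_tendsto_sum_of_condExp_eq_zero (ℱ := ℱ)
      (fun n => (EuclideanSpace.proj (𝕜 := ℝ) i).continuous.comp_stronglyMeasurable (hmeas n))
      hL2i (fun n => ?_) (hsum.of_nonneg_of_le (fun n => integral_nonneg fun ω => sq_nonneg _)
        fun n => ?_)
    · have h1 := ContinuousLinearMap.comp_condExp_comm (m := ℱ n)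
        ((hL2 n).integrable one_le_two) (EuclideanSpace.proj (𝕜 := ℝ) i)
      filter_upwards [h1, hcond n] with ω h2 h3
      have h4 : P[fun ω => d n ω i | ℱ n] ω = (EuclideanSpace.proj (𝕜 := ℝ) i) (P[d n | ℱ n] ω) :=
        h2.symm
      rw [h4, h3]; simp
    · refine integral_mono (hL2i n).integrable_sq (hL2 n).norm.integrable_sq fun ω => ?_
      exact sq_le_sq' (neg_le_of_abs_le (PiLp.norm_apply_le (d n ω) i))
        ((le_abs_self _).trans (PiLp.norm_apply_le (d n ω) i))
  filter_upwards [ae_all_iff.2 hcoord] with ω hω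
  choose c hc using hω
  refine ⟨WithLp.toLp 2 c, ?_⟩
  have h1 : Tendsto (fun n => fun i => ∑ j ∈ Finset.range n, d j ω i) atTop (𝓝 c) :=
    tendsto_pi_nhds.2 hc
  have h2 := ((PiLp.continuous_toLp 2 (fun _ : Fin k => ℝ)).tendsto c).comp h1
  refine h2.congr fun n => ?_
  ext i
  simp

end Martingale

/-! ### Deterministic weights and convergence of the decomposed noise. -/

namespace StepSizeCondition

variable {α : ℕ → ℝ} {r : ℝ}

theorem isClock (h : StepSizeCondition α r) : IsClock α (gam α) :=
  ⟨h.pos, fun _ => Finset.sum_range_succ _ _, h.tendsto_zero, h.sum_infinite⟩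

theorem gam_nonneg (h : StepSizeCondition α r) (n : ℕ) : 0 ≤ gam α n :=
  Finset.sum_nonneg fun i _ => (h.pos i).le

theorem weight_nonneg (h : StepSizeCondition α r) (n : ℕ) : 0 ≤ α n * gam α n ^ r :=
  mul_nonneg (h.pos n).le (Real.rpow_nonneg (h.gam_nonneg n) _)

theorem weight_sq (h : StepSizeCondition α r) (n : ℕ) :
    (α n * gam α n ^ r) ^ 2 = α n ^ 2 * gam α n ^ (2 * r) := by
  rw [mul_pow, ← Real.rpow_natCast (gam α n ^ r), ← Real.rpow_mul (h.gam_nonneg n)]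
  congr 2; push_cast; ring

/-- The weights `α γ ^ r` vary slowly. -/
theorem exists_abs_weight_sub_le (h : StepSizeCondition α r) :
    ∃ C, ∀ᶠ n in atTop, |α (n + 1) * gam α (n + 1) ^ r - α n * gam α n ^ r| ≤
      C * (α n ^ 2 * gam α n ^ (2 * r)) := by
  obtain ⟨C, hC⟩ := h.inv_diff_bdd
  rw [eventually_map] at hC
  have hr := h.one_lt
  have hsmall := (h.tendsto_zero.const_mul C).eventually_le_const (u := 1 / 2) (by simp)
  refine ⟨2 * C * 2 ^ r + r * 2 ^ (r - 1), ?_⟩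
  filter_upwards [hC, hsmall, h.isClock.eventually_one_le, h.isClock.eventually_succ_le_two_mul]
    with n h1 h2 h3 h4
  have hC0 : 0 ≤ C := (abs_nonneg _).trans h1
  have ha := h.pos n
  have hb := h.pos (n + 1)
  have hs := h.isClock.succ n
  have hg : 0 < gam α n := by linarith
  have hg1 : 0 < gam α (n + 1) := by linarith
  -- The bound on the increments of `1 / α` becomes `|α (n + 1) - α n| = O(α n ^ 2)`. The increment
  -- of `γ ^ r` brings another factor `α n`, so both parts are second order in `α`.
  have hdiff : α (n + 1) - α n = -(α n * α (n + 1)) * ((α (n + 1))⁻¹ - (α n)⁻¹) := by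
    field_simp
    ring
  have h5 : |α (n + 1) - α n| ≤ α n * α (n + 1) * C := by
    rw [hdiff, abs_mul, abs_neg, abs_of_pos (mul_pos ha hb)]
    gcongr
  have h6 : α (n + 1) ≤ 2 * α n := by
    have := (abs_le.1 h5).2
    nlinarith
  have h7 : |α (n + 1) - α n| ≤ 2 * C * α n ^ 2 := by
    calc _ ≤ α n * α (n + 1) * C := h5
      _ ≤ α n * (2 * α n) * C := by gcongr
      _ = _ := by ring
  have h8 : gam α (n + 1) ^ r - gam α n ^ r ≤ r * α n * (2 * gam α n) ^ (r - 1) := by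
    have h9 := rpow_add_tangent_le (a := r) hg1 hg (Or.inr hr.le)
    have h10 : gam α (n + 1) ^ (r - 1) ≤ (2 * gam α n) ^ (r - 1) :=
      Real.rpow_le_rpow hg1.le h4 (by linarith)
    have h11 : r * α n * gam α (n + 1) ^ (r - 1) ≤ r * α n * (2 * gam α n) ^ (r - 1) := by
      gcongr
    rw [hs] at h9 h11 ⊢
    linarith
  have h9 : 0 ≤ gam α (n + 1) ^ r - gam α n ^ r :=
    sub_nonneg.2 (Real.rpow_le_rpow hg.le (h.isClock.monotone n.le_succ) (by linarith))
  have h10 : gam α (n + 1) ^ r ≤ 2 ^ r * gam α n ^ (2 * r) := by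
    calc gam α (n + 1) ^ r ≤ (2 * gam α n) ^ r := Real.rpow_le_rpow hg1.le h4 (by linarith)
      _ = 2 ^ r * gam α n ^ r := Real.mul_rpow (by norm_num) hg.le
      _ ≤ _ := by
        gcongr
        linarith
  have h11 : (2 * gam α n) ^ (r - 1) ≤ 2 ^ (r - 1) * gam α n ^ (2 * r) := by
    rw [Real.mul_rpow (by norm_num) hg.le]
    gcongr
    linarith
  calc |α (n + 1) * gam α (n + 1) ^ r - α n * gam α n ^ r|
      = |(α (n + 1) - α n) * gam α (n + 1) ^ r + α n * (gam α (n + 1) ^ r - gam α n ^ r)| := by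
        congr 1; ring
    _ ≤ |α (n + 1) - α n| * gam α (n + 1) ^ r + α n * (gam α (n + 1) ^ r - gam α n ^ r) := by
        refine (abs_add_le _ _).trans_eq ?_
        rw [abs_mul, abs_mul, abs_of_pos ha, abs_of_nonneg h9,
          abs_of_nonneg (Real.rpow_nonneg hg1.le r)]
    _ ≤ (2 * C * α n ^ 2) * (2 ^ r * gam α n ^ (2 * r)) +
          α n * (r * α n * (2 ^ (r - 1) * gam α n ^ (2 * r))) := by
        gcongr
        refine h8.trans ?_
        gcongr
    _ = _ := by ring

/-- Young's inequality for the weights of the Hölder remainder. -/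
theorem weight_mul_rpow_le (h : StepSizeCondition α r) :
    ∀ᶠ n in atTop, α n * gam α n ^ r * α n ^ (2 / 3 : ℝ) ≤
      α n ^ 2 * gam α n ^ (2 * r) + α n * gam α n ^ (-r) := by
  filter_upwards [h.isClock.eventually_one_le] with n h1
  have ha := h.pos n
  have hg : 0 < gam α n := by linarith
  have h2 := Real.geom_mean_le_arith_mean2_weighted (w₁ := 2 / 3) (w₂ := 1 / 3)
    (p₁ := α n ^ 2 * gam α n ^ (2 * r)) (p₂ := α n * gam α n ^ (-r)) (by norm_num) (by norm_num)
    (by positivity) (by positivity) (by norm_num)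
  have h3 : (α n ^ 2 * gam α n ^ (2 * r)) ^ (2 / 3 : ℝ) * (α n * gam α n ^ (-r)) ^ (1 / 3 : ℝ) =
      α n * gam α n ^ r * α n ^ (2 / 3 : ℝ) := by
    rw [Real.mul_rpow (by positivity) (by positivity), Real.mul_rpow (by positivity)
      (by positivity), ← Real.rpow_natCast, ← Real.rpow_mul ha.le, ← Real.rpow_mul hg.le,
      ← Real.rpow_mul hg.le]
    rw [show ∀ a b c d : ℝ, a * b * (c * d) = (a * c) * (b * d) by intros; ring,
      ← Real.rpow_add ha, ← Real.rpow_add hg]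
    rw [show α n * gam α n ^ r * α n ^ (2 / 3 : ℝ) = α n ^ (1 : ℝ) * α n ^ (2 / 3 : ℝ) *
      gam α n ^ r by rw [Real.rpow_one]; ring, ← Real.rpow_add ha]
    congr 2
    · norm_num
    · ring
  rw [h3] at h2
  have h4 : 0 ≤ α n ^ 2 * gam α n ^ (2 * r) := by positivity
  have h5 : 0 ≤ α n * gam α n ^ (-r) := by positivity
  linarith

/-- Convergence of the weighted noise, given its decomposition into a convergent series, a
telescoping part and a small remainder. -/
theorem exists_tendsto_noise {E : Type*} [NormedAddCommGroup E] [NormedSpace ℝ E] [CompleteSpace E]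
    (h : StepSizeCondition α r) {m T V ξ : ℕ → E} {φ : ℕ → ℝ}
    (hξ : ∀ n, ξ n = m n + (T n - T (n + 1)) + V n) (hφ : ∀ n, 1 ≤ φ n)
    (hT : ∀ n, ‖T n‖ ≤ φ n) (hV : ∀ n, ‖V n‖ ≤ α n ^ (2 / 3 : ℝ) * φ (n + 1) ^ 2)
    (hm : ∃ c, Tendsto (fun n => ∑ i ∈ Finset.range n, (α i * gam α i ^ r) • m i) atTop (𝓝 c))
    (h0 : Summable fun n => α n ^ 2 * gam α n ^ (2 * r) * φ n ^ 2)
    (h1 : Summable fun n => α n ^ 2 * gam α n ^ (2 * r) * φ (n + 1) ^ 2)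
    (h2 : Summable fun n => α n * gam α n ^ (-r) * φ (n + 1) ^ 2) :
    ∃ s, Tendsto (fun n => ∑ i ∈ Finset.range n, (α i * gam α i ^ r) • ξ i) atTop (𝓝 s) := by
  set β : ℕ → ℝ := fun n => α n * gam α n ^ r with hβ
  obtain ⟨c, hc⟩ := hm
  have hVsum : Summable fun n => β n • V n := by
    refine (h1.add h2).of_norm_bounded_eventually_nat ?_
    filter_upwards [h.weight_mul_rpow_le] with n h3
    rw [norm_smul, Real.norm_of_nonneg (h.weight_nonneg n)]
    calc β n * ‖V n‖ ≤ β n * (α n ^ (2 / 3 : ℝ) * φ (n + 1) ^ 2) :=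
          mul_le_mul_of_nonneg_left (hV n) (h.weight_nonneg n)
      _ = (α n * gam α n ^ r * α n ^ (2 / 3 : ℝ)) * φ (n + 1) ^ 2 := by ring
      _ ≤ _ := by
        rw [← add_mul]
        gcongr
  have hTsum : Summable fun n => (β (n + 1) - β n) • T (n + 1) := by
    obtain ⟨C, hC⟩ := h.exists_abs_weight_sub_le
    refine (h1.mul_left C).of_norm_bounded_eventually_nat ?_
    filter_upwards [hC] with n h3
    rw [norm_smul, Real.norm_eq_abs, ← mul_assoc]
    have h4 : ‖T (n + 1)‖ ≤ φ (n + 1) ^ 2 := by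
      nlinarith [hT (n + 1), hφ (n + 1)]
    exact mul_le_mul h3 h4 (norm_nonneg _) ((abs_nonneg _).trans h3)
  -- The squares of `β n * φ n` are the terms of the convergent series `h0`.
  have hbdry : Tendsto (fun n => β n • T n) atTop (𝓝 0) := by
    rw [tendsto_zero_iff_norm_tendsto_zero]
    have h3 : Tendsto (fun n => √(β n ^ 2 * φ n ^ 2)) atTop (𝓝 √0) := by
      refine (Real.continuous_sqrt.tendsto 0).comp ?_
      simp_rw [hβ, h.weight_sq]
      exact h0.tendsto_atTop_zero
    rw [Real.sqrt_zero] at h3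
    refine squeeze_zero (fun n => norm_nonneg _) (fun n => ?_) h3
    have hφn : 0 ≤ φ n := zero_le_one.trans (hφ n)
    rw [← mul_pow, Real.sqrt_sq (mul_nonneg (h.weight_nonneg n) hφn), norm_smul,
      Real.norm_of_nonneg (h.weight_nonneg n)]
    exact mul_le_mul_of_nonneg_left (hT n) (h.weight_nonneg n)
  have hsum : ∀ n, ∑ i ∈ Finset.range n, β i • ξ i = ∑ i ∈ Finset.range n, β i • m i +
      (β 0 • T 0 - β n • T n + ∑ i ∈ Finset.range n, (β (i + 1) - β i) • T (i + 1)) +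
      ∑ i ∈ Finset.range n, β i • V i := by
    intro n
    induction n with
    | zero => simp
    | succ n ih =>
      have h3 := hξ n
      simp only [Finset.sum_range_succ, ih, h3, smul_add, smul_sub, sub_smul _ _ (T (n + 1))]
      abel
  refine ⟨_, Tendsto.congr (fun n => (hsum n).symm)
    ((hc.add ((hbdry.const_sub _).add hTsum.hasSum.tendsto_sum_nat)).add
      hVsum.hasSum.tendsto_sum_nat)⟩

end StepSizeCondition

/-! ### The noise of the controlled Markov process. -/

section Noise

variable {Ω : Type*} {mΩ : MeasurableSpace Ω} {P : Measure Ω}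
  {dθ dz : ℕ} {α : ℕ → ℝ} {r : ℝ}
  {F : Eucl dθ → Eucl dz → Eucl dθ} {K : Eucl dθ → Kernel (Eucl dz) (Eucl dz)}
  {θ : ℕ → Ω → Eucl dθ} {Z : ℕ → Ω → Eucl dz} {f : Eucl dθ → ℝ}
  {Ft : Eucl dθ → Eucl dz → Eucl dθ} {φ : Set (Eucl dθ) → ℝ → Eucl dz → ℝ}

theorem IsMarkovStochGrad.measurable_theta (h : IsMarkovStochGrad P α F K θ Z) (n : ℕ) :
    Measurable (θ n) := by
  induction n with
  | zero => exact h.measurable_init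
  | succ n ih =>
    have h1 : Measurable fun ω => F (θ n ω) (Z (n + 1) ω) :=
      h.measurable_F.comp (ih.prodMk (h.measurable_Z (n + 1)))
    rw [funext (h.recursion n)]
    exact ih.sub (h1.const_smul (α n))

/-- The filtration generated by `θ` and `Z`. -/
def IsMarkovStochGrad.filtration (h : IsMarkovStochGrad P α F K θ Z) : Filtration ℕ mΩ where
  seq := history θ Z
  mono' _ _ hij := iSup₂_mono' fun k hk => ⟨k, hk.trans hij, le_rfl⟩
  le' _ := iSup₂_le fun k _ =>
    sup_le (h.measurable_theta k).comap_le (h.measurable_Z k).comap_le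

theorem measurable_theta_history {k n : ℕ} (hk : k ≤ n) : Measurable[history θ Z n] (θ k) :=
  (comap_measurable (θ k)).mono (le_sup_left.trans (le_iSup₂_of_le k hk le_rfl)) le_rfl

theorem measurable_Z_history {k n : ℕ} (hk : k ≤ n) : Measurable[history θ Z n] (Z k) :=
  (comap_measurable (Z k)).mono (le_sup_right.trans (le_iSup₂_of_le k hk le_rfl)) le_rfl

/-- The event that `θ` stays in `Q` before time `n`. -/
def stayed (θ : ℕ → Ω → Eucl dθ) (Q : Set (Eucl dθ)) (n : ℕ) : Set Ω :=
  {ω | ∀ k < n, θ k ω ∈ Q}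

theorem le_hittingAfter_eq_stayed (Q : Set (Eucl dθ)) (n : ℕ) :
    {ω | WithTop.some n ≤ hittingAfter θ Qᶜ 0 ω} = stayed θ Q n := by
  ext ω
  have := hittingAfter_lt_iff (u := θ) (s := Qᶜ) (n := 0) (i := n) (ω := ω)
  simp only [stayed, Set.mem_ofPred_eq]
  rw [← not_lt]
  erw [this]
  simp

/-- Only the indices `i < n ≤ k + 1` matter: `stayed θ Q (n + 1)` is known at time `n`, so it can
cut off the martingale difference taken from `n` to `n + 1`. -/
theorem measurableSet_stayed {Q : Set (Eucl dθ)} (hQ : MeasurableSet Q) {n k : ℕ} (hk : n ≤ k + 1) :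
    MeasurableSet[history θ Z k] (stayed θ Q n) := by
  have : stayed θ Q n = ⋂ i, ⋂ _ : i < n, θ i ⁻¹' Q := by ext; simp [stayed]
  rw [this]
  exact MeasurableSet.iInter fun i => MeasurableSet.iInter fun hi =>
    measurable_theta_history (by omega) hQ

/-- The kernels are not assumed measurable in the parameter, so joint measurability is read off the
Poisson equation instead of the integral. -/
theorem PoissonCondition.measurable_kernelMean (hF : Measurable (Function.uncurry F))
    (h : PoissonCondition F K f Ft) : Measurable (Function.uncurry (kernelMean K Ft)) := by
  have h1 : Function.uncurry (kernelMean K Ft) = fun x : Eucl dθ × Eucl dz =>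
      Function.uncurry Ft x - (Function.uncurry F x - gradient f x.1) := by
    ext1 ⟨t, z⟩
    simp only [Function.uncurry_apply_pair]
    rw [h.poisson]; abel
  rw [h1]
  exact h.measurable.sub (hF.sub
    (h.locallyLipschitz_gradient.continuous.measurable.comp measurable_fst))

section Events

variable {Q : Set (Eucl dθ)} {s : ℝ} {A : Set Ω} {k : ℕ}

/-- By Tonelli the truncated series has finite expectation; on the event considered the truncation
has no effect. -/
theorem ae_summable_of_moment (hproc : IsMarkovStochGrad P α F K θ Z)
    (hφ : Measurable (φ Q s)) (hQ : MeasurableSet Q)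
    (hA : MeasurableSet[history θ Z 0] A)
    (hmom : ∀ n, ∫⁻ ω, (A ∩ stayed θ Q n).indicator
      (fun ω => ENNReal.ofReal (φ Q s (Z n ω) ^ 2)) ω ∂P ≤ k) {c : ℕ → ℝ} (hc : ∀ n, 0 ≤ c n)
    (hsum : Summable c) (j : ℕ) :
    ∀ᵐ ω ∂P, ω ∈ A → (∀ n, θ n ω ∈ Q) → Summable fun n => c n * φ Q s (Z (n + j) ω) ^ 2 := by
  set X : ℕ → Ω → ℝ≥0∞ := fun n => (A ∩ stayed θ Q n).indicator
    (fun ω => ENNReal.ofReal (φ Q s (Z n ω) ^ 2)) with hX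
  have hle := hproc.filtration.le
  have hXm : ∀ n, Measurable (X n) := fun n =>
    (((hφ.comp (hproc.measurable_Z n)).pow_const 2).ennreal_ofReal).indicator
      ((hle 0 _ hA).inter (hle n _ (measurableSet_stayed hQ n.le_succ)))
  have hfin : ∫⁻ ω, ∑' n, ENNReal.ofReal (c n) * X (n + j) ω ∂P ≠ ∞ := by
    rw [lintegral_tsum fun n => ((hXm _).const_mul _).aemeasurable]
    refine ne_top_of_le_ne_top (b := (∑' n, ENNReal.ofReal (c n)) * k) ?_ ?_
    · exact ENNReal.mul_ne_top hsum.tsum_ofReal_ne_top (ENNReal.natCast_ne_top k)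
    · rw [← ENNReal.tsum_mul_right]
      refine ENNReal.tsum_le_tsum fun n => ?_
      rw [lintegral_const_mul _ (hXm _)]
      gcongr
      exact hmom _
  filter_upwards [ae_lt_top' (AEMeasurable.tsum fun n =>
    ((hXm _).const_mul _).aemeasurable) hfin] with ω hω hωA hωQ
  have h1 : ∀ n, ENNReal.ofReal (c n) * X (n + j) ω =
      ENNReal.ofReal (c n * φ Q s (Z (n + j) ω) ^ 2) := fun n => by
    have : ω ∈ A ∩ stayed θ Q (n + j) := ⟨hωA, fun i _ => hωQ i⟩
    simp only [hX]
    rw [Set.indicator_of_mem this, ENNReal.ofReal_mul (hc n)]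
  simp_rw [h1] at hω
  have h2 := ENNReal.summable_toReal hω.ne
  refine h2.congr fun n => ?_
  rw [ENNReal.toReal_ofReal (mul_nonneg (hc n) (sq_nonneg _))]

end Events

variable [IsProbabilityMeasure P]

/-- Almost every `ω` lies in an event of the initial σ-algebra on which the stopped second moments
are bounded. -/
theorem MomentCondition.exists_events (hproc : IsMarkovStochGrad P α F K θ Z)
    (hmom : MomentCondition P θ Z φ) {Q : Set (Eucl dθ)} (hQ : IsCompact Q) {s : ℝ}
    (hs : s ∈ Set.Ioo (0 : ℝ) 1) :
    ∃ A : ℕ → Set Ω, (∀ k, MeasurableSet[history θ Z 0] (A k)) ∧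
      (∀ᵐ ω ∂P, ∃ k, ω ∈ A k) ∧
      ∀ k n, ∫⁻ ω, (A k ∩ stayed θ Q n).indicator
        (fun ω => ENNReal.ofReal (φ Q s (Z n ω) ^ 2)) ω ∂P ≤ k := by
  have hle : history θ Z 0 ≤ mΩ := hproc.filtration.le 0
  set X : ℕ → Ω → ℝ≥0∞ := fun n => (stayed θ Q n).indicator
    fun ω => ENNReal.ofReal (φ Q s (Z n ω) ^ 2) with hX
  have hsup := hmom Q s hQ hs
  simp only [le_hittingAfter_eq_stayed] at hsup
  -- The unconditional moments may be infinite. Sublevel sets of the conditional bound belong to the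
  -- initial σ-algebra, so integrating over them gives genuine moment bounds.
  refine ⟨fun k => {ω | ⨆ n, condLExp (history θ Z 0) P (X n) ω ≤ k}, fun k => ?_, ?_,
    fun k n => ?_⟩
  · exact (Measurable.iSup fun n => measurable_condLExp (history θ Z 0) P (X n)) measurableSet_Iic
  · filter_upwards [hsup] with ω hω
    obtain ⟨k, hk⟩ := ENNReal.exists_nat_gt hω.ne
    exact ⟨k, hk.le⟩
  · set A : Set Ω := {ω | ⨆ n, condLExp (history θ Z 0) P (X n) ω ≤ k} with hA
    have hAm : MeasurableSet[history θ Z 0] A :=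
      (Measurable.iSup fun n => measurable_condLExp (history θ Z 0) P (X n)) measurableSet_Iic
    have h1 : ∫⁻ ω, (A ∩ stayed θ Q n).indicator
        (fun ω => ENNReal.ofReal (φ Q s (Z n ω) ^ 2)) ω ∂P = ∫⁻ ω in A, X n ω ∂P := by
      rw [← lintegral_indicator (hle _ hAm), hX, Set.indicator_indicator]
    rw [h1, ← setLIntegral_condLExp hle P (X n) hAm]
    calc ∫⁻ ω in A, condLExp (history θ Z 0) P (X n) ω ∂P ≤ ∫⁻ _ in A, k ∂P := by
          refine setLIntegral_mono measurable_const fun ω hω => ?_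
          exact (le_iSup (fun n => condLExp (history θ Z 0) P (X n) ω) n).trans hω
      _ = k * P A := setLIntegral_const _ _
      _ ≤ k * 1 := by gcongr; exact prob_le_one
      _ = k := mul_one _

variable {Q : Set (Eucl dθ)} {s : ℝ} {A : Set Ω} {k : ℕ}

/-- Convergence of the martingale part of the noise. -/
theorem ae_exists_tendsto_martingale_part (hproc : IsMarkovStochGrad P α F K θ Z)
    (hα : StepSizeCondition α r) (hpoisson : PoissonCondition F K f Ft)
    (hφ : Measurable (φ Q s)) (hφ1 : ∀ z, 1 ≤ φ Q s z)
    (hbound : ∀ t ∈ Q, ∀ z, max ‖F t z‖ (max ‖Ft t z‖ ‖kernelMean K Ft t z‖) ≤ φ Q s z)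
    (hQ : MeasurableSet Q) (hA : MeasurableSet[history θ Z 0] A)
    (hmom : ∀ n, ∫⁻ ω, (A ∩ stayed θ Q n).indicator
      (fun ω => ENNReal.ofReal (φ Q s (Z n ω) ^ 2)) ω ∂P ≤ k) :
    ∀ᵐ ω ∂P, ω ∈ A → (∀ n, θ n ω ∈ Q) → ∃ c, Tendsto (fun n => ∑ i ∈ Finset.range n,
      (α i * gam α i ^ r) • (Ft (θ i ω) (Z (i + 1) ω) - kernelMean K Ft (θ i ω) (Z i ω)))
        atTop (𝓝 c) := by
  have hle := hproc.filtration.le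
  have hmono : Monotone (history θ Z) := fun i j hij => hproc.filtration.mono hij
  set β : ℕ → ℝ := fun n => α n * gam α n ^ r with hβ
  have hβ0 : ∀ n, 0 ≤ β n := hα.weight_nonneg
  set ψ : ℕ → Ω → ℝ := fun n => (A ∩ stayed θ Q n).indicator (fun ω => φ Q s (Z n ω)) with hψ
  have hψm : ∀ n, Measurable (ψ n) := fun n => (hφ.comp (hproc.measurable_Z n)).indicator
      ((hle 0 _ hA).inter (hle n _ (measurableSet_stayed hQ n.le_succ)))
  have hψ0 : ∀ n ω, 0 ≤ ψ n ω := fun n ω =>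
    Set.indicator_nonneg (fun ω _ => zero_le_one.trans (hφ1 _)) ω
  have hψsq : ∀ n, ∫⁻ ω, ENNReal.ofReal (ψ n ω ^ 2) ∂P ≤ k := fun n => by
    refine le_trans (lintegral_mono fun ω => ?_) (hmom n)
    by_cases hω : ω ∈ A ∩ stayed θ Q n <;> simp [hψ, hω]
  have hψint : ∀ n, Integrable (fun ω => ψ n ω ^ 2) P := fun n => by
    refine ⟨((hψm n).pow_const 2).aestronglyMeasurable, ?_⟩
    rw [hasFiniteIntegral_iff_ofReal (Eventually.of_forall fun ω => sq_nonneg _)]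
    exact (hψsq n).trans_lt (ENNReal.natCast_lt_top k)
  have hψL2 : ∀ n, MemLp (ψ n) 2 P := fun n =>
    (memLp_two_iff_integrable_sq (hψm n).aestronglyMeasurable).2 (hψint n)
  have hψle : ∀ n, ∫ ω, ψ n ω ^ 2 ∂P ≤ k := fun n => by
    rw [integral_eq_lintegral_of_nonneg_ae (Eventually.of_forall fun ω => sq_nonneg _)
      ((hψm n).pow_const 2).aestronglyMeasurable]
    exact ENNReal.toReal_le_of_le_ofReal (Nat.cast_nonneg k) (by simpa using hψsq n)
  -- `D n` includes `θ n ∈ Q`, needed to bound `Ft (θ n)`. It is the same event as in `ψ (n + 1)`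
  -- and lies inside the one in `ψ n`.
  set D : ℕ → Set Ω := fun n => A ∩ stayed θ Q (n + 1) with hD
  have hDm : ∀ n, MeasurableSet[history θ Z n] (D n) := fun n =>
    (hmono (Nat.zero_le n) _ hA).inter (measurableSet_stayed hQ le_rfl)
  have hT := hpoisson.measurable_kernelMean hproc.measurable_F
  set g : ℕ → Ω → Eucl dz → Eucl dθ := fun n ω z =>
    (D n).indicator (fun ω => β n • Ft (θ n ω) z) ω with hg
  set b : ℕ → Ω → Eucl dθ := fun n =>
    (D n).indicator (fun ω => β n • kernelMean K Ft (θ n ω) (Z n ω)) with hb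
  have hgm : ∀ n, Measurable[(history θ Z n).prod inferInstance] (Function.uncurry (g n)) := by
    intro n
    have h1 : Function.uncurry (g n) = (Prod.fst ⁻¹' D n).indicator
        fun x : Ω × Eucl dz => β n • Ft (θ n x.1) x.2 := by
      ext1 ⟨ω, z⟩
      by_cases hω : ω ∈ D n <;> simp [hg, hω]
    rw [h1]
    have h2 : Measurable[(history θ Z n).prod inferInstance, history θ Z n]
        (Prod.fst : Ω × Eucl dz → Ω) :=
      @measurable_fst _ _ (history θ Z n) _
    have h3 : Measurable[(history θ Z n).prod inferInstance] (Prod.snd : Ω × Eucl dz → Eucl dz) :=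
      @measurable_snd _ _ (history θ Z n) _
    have h4 : Measurable[(history θ Z n).prod inferInstance]
        (fun x : Ω × Eucl dz => Ft (θ n x.1) x.2) :=
      hpoisson.measurable.comp (((measurable_theta_history le_rfl).comp h2).prodMk h3)
    exact (h4.const_smul (β n)).indicator (h2 (hDm n))
  have hgZm : ∀ n, Measurable[history θ Z (n + 1)] (fun ω => g n ω (Z (n + 1) ω)) := fun n =>
    (((hpoisson.measurable.comp ((measurable_theta_history n.le_succ).prodMk
      (measurable_Z_history le_rfl))).const_smul (β n)).indicator
        (hmono n.le_succ _ (hDm n)))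
  have hbm : ∀ n, Measurable[history θ Z n] (b n) := fun n =>
    ((hT.comp ((measurable_theta_history le_rfl).prodMk
      (measurable_Z_history le_rfl))).const_smul (β n)).indicator (hDm n)
  have hgle : ∀ n ω, ‖g n ω (Z (n + 1) ω)‖ ≤ ‖β n * ψ (n + 1) ω‖ := by
    intro n ω
    rw [Real.norm_of_nonneg (mul_nonneg (hβ0 n) (hψ0 _ _))]
    by_cases hω : ω ∈ D n
    · simp only [hg, hψ]
      rw [Set.indicator_of_mem hω, Set.indicator_of_mem hω, norm_smul,
        Real.norm_of_nonneg (hβ0 n)]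
      exact mul_le_mul_of_nonneg_left (((le_max_left _ _).trans (le_max_right _ _)).trans
        (hbound _ (hω.2 n n.lt_succ_self) _)) (hβ0 n)
    · simp only [hg]
      rw [Set.indicator_of_notMem hω, norm_zero]
      exact mul_nonneg (hβ0 n) (hψ0 _ _)
  have hble : ∀ n ω, ‖b n ω‖ ≤ ‖β n * ψ n ω‖ := by
    intro n ω
    rw [Real.norm_of_nonneg (mul_nonneg (hβ0 n) (hψ0 _ _))]
    by_cases hω : ω ∈ D n
    · have hω' : ω ∈ A ∩ stayed θ Q n := ⟨hω.1, fun i hi => hω.2 i (hi.trans n.lt_succ_self)⟩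
      simp only [hb, hψ]
      rw [Set.indicator_of_mem hω, Set.indicator_of_mem hω', norm_smul,
        Real.norm_of_nonneg (hβ0 n)]
      exact mul_le_mul_of_nonneg_left (((le_max_right _ _).trans (le_max_right _ _)).trans
        (hbound _ (hω.2 n n.lt_succ_self) _)) (hβ0 n)
    · simp only [hb]
      rw [Set.indicator_of_notMem hω, norm_zero]
      exact mul_nonneg (hβ0 n) (hψ0 _ _)
  have hgL2 : ∀ n, MemLp (fun ω => g n ω (Z (n + 1) ω)) 2 P := fun n =>
    ((hψL2 (n + 1)).const_mul (β n)).mono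
      ((hgZm n).mono (hle (n + 1)) le_rfl).aestronglyMeasurable
      (Eventually.of_forall (hgle n))
  have hbL2 : ∀ n, MemLp (b n) 2 P := fun n =>
    ((hψL2 n).const_mul (β n)).mono ((hbm n).mono (hle n) le_rfl).aestronglyMeasurable
      (Eventually.of_forall (hble n))
  have hdL2 : ∀ n, MemLp (fun ω => g n ω (Z (n + 1) ω) - b n ω) 2 P :=
    fun n => (hgL2 n).sub (hbL2 n)
  have hconv := ae_exists_tendsto_sum_of_condExp_eq_zero_eucl (P := P) (ℱ := hproc.filtration)
    (d := fun n ω => g n ω (Z (n + 1) ω) - b n ω)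
    (fun n => ((hgZm n).sub ((hbm n).mono (hmono n.le_succ) le_rfl)).stronglyMeasurable)
    hdL2 (fun n => ?_) ?_
  · filter_upwards [hconv] with ω ⟨c, hc⟩ hωA hωQ
    refine ⟨c, hc.congr fun n => Finset.sum_congr rfl fun i _ => ?_⟩
    have hω : ω ∈ D i := ⟨hωA, fun j _ => hωQ j⟩
    simp only [hg, hb]
    rw [Set.indicator_of_mem hω, Set.indicator_of_mem hω, smul_sub]
  · have h1 := condExp_sub (m := hproc.filtration n) ((hgL2 n).integrable one_le_two)
      ((hbL2 n).integrable one_le_two)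
    have h2 := condExp_ae_eq_integral_of_le (hle n) (hproc.measurable_Z (n + 1))
      (κ := fun ω => K (θ n ω) (Z n ω))
      (fun ω => (hproc.markovKernel (θ n ω)).isProbabilityMeasure _) (hproc.controlled n)
      (g := g n) (hgm n).stronglyMeasurable ((hgL2 n).integrable one_le_two)
    have h3 := condExp_of_stronglyMeasurable (hle n) (hbm n).stronglyMeasurable
      ((hbL2 n).integrable one_le_two)
    filter_upwards [h1, h2] with ω h4 h5
    refine h4.trans ?_
    rw [Pi.sub_apply, h5, h3, Pi.zero_apply, sub_eq_zero]
    simp only [hg, hb]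
    by_cases hω : ω ∈ D n
    · simp only [Set.indicator_of_mem hω]
      rw [integral_smul, kernelMean]
    · simp only [Set.indicator_of_notMem hω, integral_zero]
  · refine ((hα.summable.mul_right (4 * (k : ℝ)))).of_nonneg_of_le
      (fun n => integral_nonneg fun ω => sq_nonneg _) fun n => ?_
    rw [← hα.weight_sq]
    calc ∫ ω, ‖g n ω (Z (n + 1) ω) - b n ω‖ ^ 2 ∂P
        ≤ ∫ ω, 2 * β n ^ 2 * (ψ (n + 1) ω ^ 2 + ψ n ω ^ 2) ∂P := by
          refine integral_mono (hdL2 n).norm.integrable_sq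
            (((hψint (n + 1)).add (hψint n)).const_mul _) fun ω => ?_
          have h1 := hgle n ω
          have h2 := hble n ω
          rw [Real.norm_of_nonneg (mul_nonneg (hβ0 n) (hψ0 _ _))] at h1 h2
          calc ‖g n ω (Z (n + 1) ω) - b n ω‖ ^ 2
              ≤ (β n * ψ (n + 1) ω + β n * ψ n ω) ^ 2 :=
                pow_le_pow_left₀ (norm_nonneg _) ((norm_sub_le _ _).trans (add_le_add h1 h2)) 2
            _ ≤ _ := by
              nlinarith [mul_nonneg (sq_nonneg (β n)) (sq_nonneg (ψ (n + 1) ω - ψ n ω))]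
      _ = 2 * β n ^ 2 * (∫ ω, ψ (n + 1) ω ^ 2 ∂P + ∫ ω, ψ n ω ^ 2 ∂P) := by
          rw [integral_const_mul, integral_add (hψint (n + 1)) (hψint n)]
      _ ≤ 2 * β n ^ 2 * (k + k) := by
          gcongr
          · exact hψle _
          · exact hψle _
      _ = _ := by ring

end Noise

section Noise

variable {Ω : Type*} {mΩ : MeasurableSpace Ω} {P : Measure Ω} [IsProbabilityMeasure P]
  {dθ dz : ℕ} {α : ℕ → ℝ} {r : ℝ}
  {F : Eucl dθ → Eucl dz → Eucl dθ} {K : Eucl dθ → Kernel (Eucl dz) (Eucl dz)}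
  {θ : ℕ → Ω → Eucl dθ} {Z : ℕ → Ω → Eucl dz} {f : Eucl dθ → ℝ}
  {Ft : Eucl dθ → Eucl dz → Eucl dθ} {φ : Set (Eucl dθ) → ℝ → Eucl dz → ℝ}

/-- Almost surely on the event that `θ` is bounded, the weighted noise series converges. -/
theorem ae_exists_tendsto_noise (hproc : IsMarkovStochGrad P α F K θ Z)
    (hα : StepSizeCondition α r) (hpoisson : PoissonCondition F K f Ft)
    (hreg : RegularityCondition F K Ft φ) (hmom : MomentCondition P θ Z φ) :
    ∀ᵐ ω ∂P, BddAbove (Set.range fun n => ‖θ n ω‖) → ∃ s, Tendsto (fun n =>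
      ∑ i ∈ Finset.range n, (α i * gam α i ^ r) •
        (F (θ i ω) (Z (i + 1) ω) - gradient f (θ i ω))) atTop (𝓝 s) := by
  -- With Hölder exponent `2 / 3` the remainder has weight `α ^ (5 / 3) γ ^ r`, the geometric mean
  -- of `α² γ ^ (2 r)` and `α γ ^ (-r)` with weights `2 / 3` and `1 / 3`. Both are summable, the
  -- second because `r > 1`.
  have hs : (2 / 3 : ℝ) ∈ Set.Ioo (0 : ℝ) 1 := by norm_num
  have hball : ∀ N : ℕ, ∀ᵐ ω ∂P, (∀ n, θ n ω ∈ Metric.closedBall (0 : Eucl dθ) N) →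
      ∃ s, Tendsto (fun n => ∑ i ∈ Finset.range n, (α i * gam α i ^ r) •
        (F (θ i ω) (Z (i + 1) ω) - gradient f (θ i ω))) atTop (𝓝 s) := by
    intro N
    set Q := Metric.closedBall (0 : Eucl dθ) (N : ℝ) with hQdef
    have hQ : IsCompact Q := isCompact_closedBall _ _
    have hQm : MeasurableSet Q := measurableSet_closedBall
    obtain ⟨A, hAm, hA, hbd⟩ := hmom.exists_events hproc hQ hs
    have hφ := hreg.measurable Q _ hQ hs
    have hφ1 := hreg.one_le Q _ hQ hs
    have hbound := hreg.bound Q _ hQ hs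
    have h1 := fun k => ae_exists_tendsto_martingale_part hproc hα hpoisson hφ hφ1 hbound hQm
      (hAm k) (hbd k)
    have hc0 : ∀ n, 0 ≤ α n ^ 2 * gam α n ^ (2 * r) := fun n => by
      rw [← hα.weight_sq]; exact sq_nonneg _
    have hc1 : ∀ n, 0 ≤ α n * gam α n ^ (-r) := fun n =>
      mul_nonneg (hα.pos n).le (Real.rpow_nonneg (hα.gam_nonneg n) _)
    have h2 := fun k => ae_summable_of_moment hproc hφ hQm (hAm k) (hbd k) hc0 hα.summable 0
    have h3 := fun k => ae_summable_of_moment hproc hφ hQm (hAm k) (hbd k) hc0 hα.summable 1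
    have h4 := fun k => ae_summable_of_moment hproc hφ hQm (hAm k) (hbd k) hc1
      (hα.isClock.summable_mul_rpow_neg hα.one_lt) 1
    filter_upwards [hA, ae_all_iff.2 h1, ae_all_iff.2 h2, ae_all_iff.2 h3, ae_all_iff.2 h4]
      with ω ⟨k, hk⟩ g1 g2 g3 g4 hω
    refine hα.exists_tendsto_noise (φ := fun n => φ Q (2 / 3) (Z n ω))
      (T := fun n => kernelMean K Ft (θ n ω) (Z n ω))
      (V := fun n => kernelMean K Ft (θ (n + 1) ω) (Z (n + 1) ω) -
        kernelMean K Ft (θ n ω) (Z (n + 1) ω)) (fun n => ?_) (fun n => hφ1 _)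
      (fun n => ((le_max_right _ _).trans (le_max_right _ _)).trans (hbound _ (hω n) _))
      (fun n => ?_) (g1 k hk hω) (g2 k hk hω) (g3 k hk hω) (g4 k hk hω)
    · rw [hpoisson.poisson]; abel
    · have g5 := hreg.holder Q _ hQ hs _ (hω (n + 1)) _ (hω n) (Z (n + 1) ω)
      have g6 : ‖θ (n + 1) ω - θ n ω‖ ≤ α n * φ Q (2 / 3) (Z (n + 1) ω) := by
        rw [hproc.recursion, sub_sub_cancel_left, norm_neg, norm_smul,
          Real.norm_of_nonneg (hα.pos n).le]
        exact mul_le_mul_of_nonneg_left ((le_max_left _ _).trans (hbound _ (hω n) _))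
          (hα.pos n).le
      have g7 := hφ1 (Z (n + 1) ω)
      set y := φ Q (2 / 3) (Z (n + 1) ω)
      have hy0 : 0 ≤ y := by linarith
      calc _ ≤ y * ‖θ (n + 1) ω - θ n ω‖ ^ (2 / 3 : ℝ) := g5
        _ ≤ y * (α n * y) ^ (2 / 3 : ℝ) := by gcongr
        _ = α n ^ (2 / 3 : ℝ) * (y * y ^ (2 / 3 : ℝ)) := by
          rw [Real.mul_rpow (hα.pos n).le hy0]; ring
        _ ≤ α n ^ (2 / 3 : ℝ) * (y * y) := by
          have := (hα.pos n).le
          gcongr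
          calc y ^ (2 / 3 : ℝ) ≤ y ^ (1 : ℝ) :=
                Real.rpow_le_rpow_of_exponent_le g7 (by norm_num)
            _ = y := Real.rpow_one y
        _ = _ := by ring
  filter_upwards [ae_all_iff.2 hball] with ω hω ⟨R, hR⟩
  obtain ⟨N, hN⟩ := exists_nat_ge R
  exact hω N fun n => mem_closedBall_zero_iff.2 ((hR ⟨n, rfl⟩).trans hN)

end Noise

/-! ### The exponents, and the theorem. -/

section Exponents

theorem min_rExp_of_lt {r μ : ℝ} (h : (r : EReal) < rExp μ) :
    (min (r : EReal) (rExp μ)).toReal = r := by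
  rw [min_eq_left h.le, EReal.toReal_coe]

theorem mul_two_sub_lt_one_of_lt {r μ : ℝ} (hμ : μ ≤ 2) (h : (r : EReal) < rExp μ) :
    r * (2 - μ) < 1 := by
  unfold rExp at h
  split_ifs at h with h1
  · rw [EReal.coe_lt_coe_iff, lt_div_iff₀ (by linarith)] at h
    exact h
  · have : μ = 2 := le_antisymm hμ (not_lt.1 h1)
    simp [this]

theorem rExp_le_coe {r μ : ℝ} (h : rExp μ ≤ (r : EReal)) :
    μ < 2 ∧ 1 / (2 - μ) ≤ r ∧ (min (r : EReal) (rExp μ)).toReal = 1 / (2 - μ) := by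
  rw [min_eq_right h]
  unfold rExp at h ⊢
  split_ifs at h ⊢ with h1
  · exact ⟨h1, EReal.coe_le_coe_iff.1 h, EReal.toReal_coe _⟩
  · exact absurd h (not_le.2 (EReal.coe_lt_top r))

end Exponents

theorem theorem3p1 {Ω : Type*} [MeasurableSpace Ω] (P : Measure Ω) [IsProbabilityMeasure P]
    (dθ dz : ℕ) (α : ℕ → ℝ) (r : ℝ)
    (F : Eucl dθ → Eucl dz → Eucl dθ) (K : Eucl dθ → Kernel (Eucl dz) (Eucl dz))
    (θ : ℕ → Ω → Eucl dθ) (Z : ℕ → Ω → Eucl dz)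
    (f : Eucl dθ → ℝ) (Ft : Eucl dθ → Eucl dz → Eucl dθ)
    (φ : Set (Eucl dθ) → ℝ → Eucl dz → ℝ)
    (hproc : IsMarkovStochGrad P α F K θ Z)
    (hα : StepSizeCondition α r)
    (hpoisson : PoissonCondition F K f Ft)
    (hreg : RegularityCondition F K Ft φ)
    (hmom : MomentCondition P θ Z φ)
    (hloj : LojasiewiczCondition f) :
    ∃ θhat : Ω → Eucl dθ,
      (∀ᵐ ω ∂P, BddAbove (Set.range fun n => ‖θ n ω‖) →
        Tendsto (fun n => θ n ω) atTop (𝓝 (θhat ω)) ∧ gradient f (θhat ω) = 0) ∧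
      (∀ δ μ M : Eucl dθ → ℝ, IsLocalLojasiewicz f δ μ M →
        (∀ᵐ ω ∂P, BddAbove (Set.range fun n => ‖θ n ω‖) → (r : EReal) < rExp (μ (θhat ω)) →
          (fun n => ‖gradient f (θ n ω)‖ ^ 2) =o[atTop]
              (fun n => gam α n ^ (-pExp r (μ (θhat ω)))) ∧
          (fun n => |f (θ n ω) - f (θhat ω)|) =o[atTop]
              (fun n => gam α n ^ (-pExp r (μ (θhat ω)))) ∧
          (fun n => ‖θ n ω - θhat ω‖) =o[atTop]
              (fun n => gam α n ^ (-qExp r (μ (θhat ω))))) ∧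
        (∀ᵐ ω ∂P, BddAbove (Set.range fun n => ‖θ n ω‖) → rExp (μ (θhat ω)) ≤ (r : EReal) →
          (fun n => ‖gradient f (θ n ω)‖ ^ 2) =O[atTop]
              (fun n => gam α n ^ (-pExp r (μ (θhat ω)))) ∧
          (fun n => |f (θ n ω) - f (θhat ω)|) =O[atTop]
              (fun n => gam α n ^ (-pExp r (μ (θhat ω)))) ∧
          (fun n => ‖θ n ω - θhat ω‖) =O[atTop]
              (fun n => gam α n ^ (-qExp r (μ (θhat ω)))))) ∧
      (∀ᵐ ω ∂P, BddAbove (Set.range fun n => ‖θ n ω‖) →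
        (fun n => ‖gradient f (θ n ω)‖ ^ 2) =o[atTop] (fun n => gam α n ^ (-min 1 r)) ∧
        (fun n => |f (θ n ω) - f (θhat ω)|) =o[atTop] (fun n => gam α n ^ (-min 1 r))) := by
  classical
  have hclock := hα.isClock
  have hpath := (ae_exists_tendsto_noise hproc hα hpoisson hreg hmom).mono fun ω hω hbdd =>
    gradient_search_rates hclock hα.one_lt hpoisson.differentiable
      hpoisson.locallyLipschitz_gradient hloj (θ := fun n => θ n ω)
      (ξ := fun n => F (θ n ω) (Z (n + 1) ω) - gradient f (θ n ω))
      (fun n => by rw [add_sub_cancel]; exact hproc.recursion n ω) hbdd (hω hbdd).choose_spec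
  -- The limit is fixed before the Łojasiewicz constants are given, with value `0` where no limit
  -- exists.
  set θhat : Ω → Eucl dθ := fun ω =>
    if h : ∃ y, Tendsto (fun n => θ n ω) atTop (𝓝 y) then h.choose else 0 with hθhat
  have hlim : ∀ ω y, Tendsto (fun n => θ n ω) atTop (𝓝 y) → θhat ω = y := by
    intro ω y hy
    have hex : ∃ y, Tendsto (fun n => θ n ω) atTop (𝓝 y) := ⟨y, hy⟩
    simp only [hθhat, dif_pos hex]
    exact tendsto_nhds_unique hex.choose_spec hy
  refine ⟨θhat, ?_, fun δ μ M hL => ⟨?_, ?_⟩, ?_⟩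
  · filter_upwards [hpath] with ω hω hbdd
    obtain ⟨y, hy, hy0, -⟩ := hω hbdd
    rw [hlim ω y hy]
    exact ⟨hy, hy0⟩
  · filter_upwards [hpath] with ω hω hbdd hr
    obtain ⟨y, hy, -, hrate⟩ := hω hbdd
    rw [hlim ω y hy] at hr ⊢
    have := (hrate (δ y) (hL.delta_mem y).1 (μ y) (hL.mu_mem y) (M y)
      (zero_lt_one.trans_le (hL.M_mem y)) (hL.ineq y) r hα.one_lt le_rfl).2
      (mul_two_sub_lt_one_of_lt (hL.mu_mem y).2 hr)
    rwa [pExp, qExp, min_rExp_of_lt hr]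
  · filter_upwards [hpath] with ω hω hbdd hr
    obtain ⟨y, hy, -, hrate⟩ := hω hbdd
    rw [hlim ω y hy] at hr ⊢
    obtain ⟨h1, h2, h3⟩ := rExp_le_coe hr
    have h4 : 0 < 2 - μ y := by linarith
    have := (hrate (δ y) (hL.delta_mem y).1 (μ y) (hL.mu_mem y) (M y)
      (zero_lt_one.trans_le (hL.M_mem y)) (hL.ineq y) (1 / (2 - μ y))
      (by rw [lt_div_iff₀ h4]; linarith [(hL.mu_mem y).1]) h2).1
      (one_div_mul_cancel h4.ne').le
    rwa [pExp, qExp, h3]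
  · obtain ⟨δ, μ, M, hL⟩ := exists_isLocalLojasiewicz hpoisson.differentiable.continuous hloj
    filter_upwards [hpath] with ω hω hbdd
    obtain ⟨y, hy, -, hrate⟩ := hω hbdd
    rw [hlim ω y hy, min_eq_left hα.one_lt.le]
    -- Any local constants will do: `μ > 1` and `m > 1` give `μ m > 1 = min 1 r`, so the big-O rate
    -- already implies the little-o claim.
    obtain ⟨m, hm1, hmr, hm⟩ := PerturbedDescent.exists_exponent hα.one_lt (hL.mu_mem y)
    obtain ⟨h1, h2, -⟩ := (hrate (δ y) (hL.delta_mem y).1 (μ y) (hL.mu_mem y) (M y)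
      (zero_lt_one.trans_le (hL.M_mem y)) (hL.ineq y) m hm1 hmr).1 hm
    have hp : 1 < μ y * m := one_lt_mul_of_lt_of_le (hL.mu_mem y).1 hm1.le
    have h3 : (fun n => gam α n ^ (-(μ y * m))) =o[atTop] fun n => gam α n ^ (-1 : ℝ) :=
      hclock.isLittleO_rpow_neg (one_lt_mul_of_lt_of_le (hL.mu_mem y).1 hm1.le)
    exact ⟨h1.trans_isLittleO h3, h2.trans_isLittleO h3⟩
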